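/- Let $\mathcal T$ be the set of unlabelled non-planar rooted trees, including the empty tree $\emptyset$; write $|\tau|$ for the number of vertices and $\sigma(\tau)$ for the symmetry factor of $\tau$. Let $\mathcal H$ be the Butcher--Connes--Kreimer Hopf algebra: the free commutative $\mathbb R$-algebra on the non-empty trees, with unit $\emptyset$ and coproduct $\Delta(\tau)=\sum_c P_c(\tau)\otimes R_c(\tau)$, the sum being over all admissible cuts $c$ of $\tau$ including the empty and the total cut, where $R_c(\tau)$ is the component containing the root and $P_c(\tau)$ is the forest of the remaining components (for the total cut $R_c(\tau)=\emptyset$, $P_c(\tau)=\tau$). A character is an algebra homomorphism $\varphi:\mathcal H\to\mathbb R$; characters form a group $G$ (the Butcher group) under the convolution product $\varphi_1\varphi_2=\mu_{\mathbb R}\circ(\varphi_1\otimes\varphi_2)\circ\Delta$, whose identity is the counit $\varepsilon$. For a character $\zeta$ let $\bar\zeta$ be the character with $\bar\zeta(\tau)=(-1)^{|\tau|}\zeta(\tau)$ for $\tau\in\mathcal T$; $\zeta$ is odd if $\bar\zeta=\zeta^{-1}$. The B-series method $\Psi$ with character $\psi\in G$ assigns to every smooth vector field $f:\mathbb R^N\to\mathbb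 R^N$ ($N\ge 0$) the formal power series in $h$ $$\Psi_{h,f}(y)=B_h(\psi,f)(y)=\sum_{\tau\in\mathcal T}\frac{h^{|\tau|}}{\sigma(\tau)}\,\psi(\tau)\,F(\tau)(y),$$ where $F(\emptyset)(y)=y$ and $F([\tau_1,\dots,\tau_m])(y)=f^{(m)}(y)\bigl(F(\tau_1)(y),\dots,F(\tau_m)(y)\bigr)$. Methods are composed as formal power series in $h$ for each fixed $f$; the adjoint $\Psi^*$ of $\Psi$ is the method with $\Psi^*_{h,f}=(\Psi_{-h,f})^{-1}$, and $\Psi$ is symmetric if $\Psi=\Psi^*$. Let $\Psi$ be a B-series method with character $\psi$. Then: 1. $\Psi$ is symmetric if and only if there exists a B-series method $\Omega$ such that $\Psi=\Omega\circ\Omega^*$. 2. There is exactly one character $\psi^{1/2}\in G$ with $\psi^{1/2}\psi^{1/2}=\psi$. If $\Psi$ is symmetric, then $\psi^{1/2}$ is odd, the B-series method $\Psi^{1/2}$ with character $\psi^{1/2}$ is symmetric, and $\Psi=\Omega\circ\Omega^*$ holds with $\Omega=\Psi^{1/2}$. -/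

import Mathlib

noncomputable section

open scoped ContDiff TensorProduct

namespace BSeries

/-! ### Non-planar rooted trees -/

/-- Non-empty planar rooted trees: a root together with the list of its branches. -/
inductive PTree : Type
  | node : List PTree → PTree

/-- Elementary moves on planar trees: exchange two neighbouring branches of the root, or perform a
move inside one branch. -/
inductive PTree.Step : PTree → PTree → Prop
  | swap (l₁ : List PTree) (a b : PTree) (l₂ : List PTree) :
      PTree.Step (.node (l₁ ++ a :: b :: l₂)) (.node (l₁ ++ b :: a :: l₂))
  | child (l₁ : List PTree) (a b : PTree) (l₂ : List PTree) :
      PTree.Step a b → PTree.Step (.node (l₁ ++ a :: l₂)) (.node (l₁ ++ b :: l₂))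

/-- Non-empty, unlabelled, non-planar rooted trees: planar trees up to reordering of the branches
at every vertex. The empty tree is the unit of the algebra `H` below. -/
def RTree : Type := Quot PTree.Step

/-- The non-planar tree underlying a planar tree. -/
def RTree.mk (t : PTree) : RTree := Quot.mk _ t

theorem RTree.mk_eq_of_map_eq (p : List PTree) {l₁ l₂ : List PTree}
    (h : l₁.map RTree.mk = l₂.map RTree.mk) :
    RTree.mk (.node (p ++ l₁)) = RTree.mk (.node (p ++ l₂)) := by
  have key : ∀ (p l : List PTree) (a b : PTree), RTree.mk a = RTree.mk b →
      RTree.mk (.node (p ++ a :: l)) = RTree.mk (.node (p ++ b :: l)) := by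
    intro p l a b hab
    induction Quot.eqvGen_exact hab with
    | rel x y h => exact Quot.sound (.child _ _ _ _ h)
    | refl => rfl
    | symm x y h ih => exact (ih (Quot.eqvGen_sound h)).symm
    | trans x y z h₁ h₂ ih₁ ih₂ =>
      exact (ih₁ (Quot.eqvGen_sound h₁)).trans (ih₂ (Quot.eqvGen_sound h₂))
  induction l₁ generalizing p l₂ with
  | nil => simp_all
  | cons a l₁ ih =>
    cases l₂ with
    | nil => simp at h
    | cons b l₂ =>
      simp only [List.map_cons, List.cons.injEq] at h
      have := ih (p ++ [a]) h.2
      simp only [List.append_assoc, List.cons_append, List.nil_append] at this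
      exact this.trans (key _ _ _ _ h.1)

theorem RTree.mk_eq_of_perm (p : List PTree) {l₁ l₂ : List PTree} (h : l₁.Perm l₂) :
    RTree.mk (.node (p ++ l₁)) = RTree.mk (.node (p ++ l₂)) := by
  induction h generalizing p with
  | nil => rfl
  | cons x _ ih => simpa using ih (p ++ [x])
  | swap x y l => exact Quot.sound (.swap _ _ _ _)
  | trans _ _ ih₁ ih₂ => exact (ih₁ p).trans (ih₂ p)

/-- A planar representative of a tree. -/
def RTree.rep (τ : RTree) : PTree := Quot.out τ

theorem RTree.mk_rep (τ : RTree) : RTree.mk τ.rep = τ := Quot.out_eq τ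

/-- The tree `[τ₁, …, τₖ]` obtained by joining the roots of `τ₁, …, τₖ` to a new root. -/
def RTree.node (s : Multiset RTree) : RTree := RTree.mk (.node (s.toList.map RTree.rep))

theorem RTree.node_map_mk (ts : List PTree) :
    RTree.node (ts.map RTree.mk : List RTree) = RTree.mk (.node ts) := by
  have h : ((ts.map RTree.mk : List RTree) : Multiset RTree).toList.Perm (ts.map RTree.mk) :=
    Multiset.coe_eq_coe.mp (Multiset.coe_toList _)
  have h' := h.map RTree.rep
  refine (RTree.mk_eq_of_perm [] h').trans (RTree.mk_eq_of_map_eq [] ?_)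
  rw [List.map_map, List.map_map]
  exact List.map_congr_left fun x _ => RTree.mk_rep (RTree.mk x)

mutual
/-- The number of vertices. -/
def PTree.size : PTree → ℕ
  | .node ts => 1 + PTree.sizeList ts
/-- The number of vertices of a list of planar trees. -/
def PTree.sizeList : List PTree → ℕ
  | [] => 0
  | t :: ts => PTree.size t + PTree.sizeList ts
end

theorem PTree.sizeList_append (l₁ l₂ : List PTree) :
    sizeList (l₁ ++ l₂) = sizeList l₁ + sizeList l₂ := by
  induction l₁ with
  | nil => simp [sizeList]
  | cons a l ih => simp [sizeList, ih, add_assoc]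

theorem PTree.size_step {s t : PTree} (h : Step s t) : s.size = t.size := by
  induction h with
  | swap l₁ a b l₂ => simp only [size, sizeList_append, sizeList]; omega
  | child l₁ a b l₂ _ ih => simp only [size, sizeList_append, sizeList, ih]

/-- The number `|τ|` of vertices of a tree. -/
def RTree.size : RTree → ℕ := Quot.lift PTree.size fun _ _ => PTree.size_step

theorem PTree.finite_size_le (n : ℕ) : {t : PTree | t.size ≤ n}.Finite := by
  induction n with
  | zero =>
    convert! Set.finite_empty
    ext ⟨ts⟩
    simp [size]
  | succ n ih =>
    have hlen : ∀ ts : List PTree, ts.length ≤ sizeList ts := by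
      intro ts
      induction ts with
      | nil => simp
      | cons t ts ih => cases t; simp only [List.length_cons, sizeList, size]; omega
    have hmem : ∀ (ts : List PTree), ∀ t ∈ ts, t.size ≤ sizeList ts := by
      intro ts
      induction ts with
      | nil => simp
      | cons t ts ih =>
        intro s hs
        rcases List.mem_cons.mp hs with rfl | hs
        · simp [sizeList]
        · have := ih s hs; simp only [sizeList]; omega
    have : Finite {t : PTree | t.size ≤ n} := ih
    refine ((List.finite_length_le {t : PTree | t.size ≤ n} n).image
      (fun l => PTree.node (l.map Subtype.val))).subset ?_
    rintro ⟨ts⟩ h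
    have h : sizeList ts ≤ n := by simp only [Set.mem_ofPred_eq, size] at h; omega
    refine ⟨ts.attach.map fun t => ⟨t.1, (hmem ts t.1 t.2).trans h⟩, ?_, ?_⟩
    · simpa using (hlen ts).trans h
    · simp [Function.comp_def]

theorem RTree.finite_size_eq (n : ℕ) : {τ : RTree | τ.size = n}.Finite := by
  refine ((PTree.finite_size_le n).image RTree.mk).subset ?_
  rintro ⟨t⟩ h
  exact ⟨t, le_of_eq h, rfl⟩

/-- The finite set of trees with `n` vertices. -/
def treesOfSize (n : ℕ) : Finset RTree := (RTree.finite_size_eq n).toFinset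

open Classical in
/-- `∏ kᵢ!` over the distinct elements of a multiset, with multiplicities `kᵢ`. -/
def multFactorial (s : Multiset RTree) : ℕ := ∏ τ ∈ s.toFinset, (s.count τ).factorial

mutual
/-- The symmetry factor: `σ([τ₁^k₁, …, τₘ^kₘ]) = ∏ kᵢ! σ(τᵢ)^kᵢ` for distinct `τᵢ`. -/
def PTree.sigma : PTree → ℕ
  | .node ts => multFactorial (ts.map RTree.mk : List RTree) * PTree.sigmaList ts
/-- The product of the symmetry factors of a list of planar trees. -/
def PTree.sigmaList : List PTree → ℕ
  | [] => 1
  | t :: ts => PTree.sigma t * PTree.sigmaList ts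
end

theorem PTree.sigmaList_append (l₁ l₂ : List PTree) :
    sigmaList (l₁ ++ l₂) = sigmaList l₁ * sigmaList l₂ := by
  induction l₁ with
  | nil => simp [sigmaList]
  | cons a l ih => simp [sigmaList, ih, mul_assoc]

theorem PTree.map_mk_swap (l₁ : List PTree) (a b : PTree) (l₂ : List PTree) :
    (((l₁ ++ a :: b :: l₂).map RTree.mk : List RTree) : Multiset RTree) =
      ((l₁ ++ b :: a :: l₂).map RTree.mk : List RTree) :=
  Multiset.coe_eq_coe.mpr (((List.Perm.swap b a l₂).append_left l₁).map _)

theorem PTree.map_mk_child (l₁ : List PTree) {a b : PTree} (l₂ : List PTree) (h : Step a b) :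
    (l₁ ++ a :: l₂).map RTree.mk = (l₁ ++ b :: l₂).map RTree.mk := by
  have : RTree.mk a = RTree.mk b := Quot.sound h
  simp [this]

theorem PTree.sigma_step {s t : PTree} (h : Step s t) : s.sigma = t.sigma := by
  induction h with
  | swap l₁ a b l₂ =>
    simp only [sigma, map_mk_swap, sigmaList_append, sigmaList]
    ring
  | child l₁ a b l₂ h ih =>
    simp only [sigma, map_mk_child l₁ l₂ h, sigmaList_append, sigmaList, ih]

/-- The symmetry factor `σ(τ)`. -/
def RTree.sigma : RTree → ℕ := Quot.lift PTree.sigma fun _ _ => PTree.sigma_step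

/-! ### The Butcher–Connes–Kreimer algebra and the Butcher group -/

mutual
/-- The multiset of pairs `(P_c, R_c)` over all admissible cuts `c` of a tree other than the total
cut: `R_c` is the part containing the root, `P_c` the forest of the other components. -/
def PTree.cuts : PTree → Multiset (Multiset RTree × RTree)
  | .node ts => (PTree.childCuts ts).map fun p => (p.1, RTree.node p.2)
/-- The choices for the branches `ts` of a vertex that stays connected to the root: for every
branch either the edge leading to it is cut, and the whole branch is pruned, or this edge is kept
and an admissible cut of the branch is made. The first component collects the pruned trees, the
second one the remaining parts of the branches that are kept. -/
def PTree.childCuts : List PTree → Multiset (Multiset RTree × Multiset RTree)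
  | [] => {(0, 0)}
  | t :: ts => (PTree.childCuts ts).bind fun p =>
      (RTree.mk t ::ₘ p.1, p.2) ::ₘ (PTree.cuts t).map fun q => (q.1 + p.1, q.2 ::ₘ p.2)
end

/-- The choices for a single branch. -/
def PTree.branchCuts (t : PTree) : Multiset (Multiset RTree × Multiset RTree) :=
  ({RTree.mk t}, 0) ::ₘ (PTree.cuts t).map fun q => (q.1, {q.2})

theorem PTree.childCuts_cons (t : PTree) (ts : List PTree) :
    childCuts (t :: ts) =
      (childCuts ts).bind fun p => (branchCuts t).map fun q => q + p := by
  rw [childCuts]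
  refine Multiset.bind_congr fun p _ => ?_
  rw [branchCuts, Multiset.map_cons, Multiset.map_map]
  congr 1
  ext1 <;> simp

theorem PTree.childCuts_swap (l₁ : List PTree) (a b : PTree) (l₂ : List PTree) :
    childCuts (l₁ ++ a :: b :: l₂) = childCuts (l₁ ++ b :: a :: l₂) := by
  induction l₁ with
  | nil =>
    simp only [List.nil_append, childCuts_cons, Multiset.bind_assoc, Multiset.bind_map]
    refine Multiset.bind_congr fun p _ => ?_
    rw [Multiset.bind_map_comm]
    refine Multiset.bind_congr fun q _ => Multiset.map_congr rfl fun r _ => ?_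
    abel
  | cons c l ih => simp only [List.cons_append, childCuts_cons, ih]

theorem PTree.childCuts_child (l₁ : List PTree) {a b : PTree} (l₂ : List PTree)
    (h : RTree.mk a = RTree.mk b) (h' : cuts a = cuts b) :
    childCuts (l₁ ++ a :: l₂) = childCuts (l₁ ++ b :: l₂) := by
  induction l₁ with
  | nil => simp only [List.nil_append, childCuts, h, h']
  | cons c l ih => simp only [List.cons_append, childCuts, ih]

theorem PTree.cuts_step {s t : PTree} (h : Step s t) : s.cuts = t.cuts := by
  induction h with
  | swap l₁ a b l₂ => simp only [cuts, childCuts_swap]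
  | child l₁ a b l₂ h ih =>
    simp only [cuts, childCuts_child l₁ l₂ (Quot.sound h) ih]

/-- The pairs `(P_c(τ), R_c(τ))` over all admissible cuts `c` of `τ` other than the total cut. -/
def RTree.cuts : RTree → Multiset (Multiset RTree × RTree) :=
  Quot.lift PTree.cuts fun _ _ => PTree.cuts_step

/-- The free commutative algebra on the non-empty trees; monomials are forests, `1` is the empty
forest. -/
abbrev H : Type := MvPolynomial RTree ℝ

/-- The forest with the given trees, as an element of `H`. -/
def forest (s : Multiset RTree) : H := (s.map MvPolynomial.X).prod

/-- The coproduct `Δ(τ) = τ ⊗ 1 + ∑_c P_c(τ) ⊗ R_c(τ)`, extended multiplicatively and linearly. -/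
def coproduct : H →ₐ[ℝ] H ⊗[ℝ] H :=
  MvPolynomial.aeval fun τ =>
    (MvPolynomial.X τ : H) ⊗ₜ[ℝ] (1 : H) +
      (τ.cuts.map fun c => forest c.1 ⊗ₜ[ℝ] (MvPolynomial.X c.2 : H)).sum

/-- The counit: it vanishes on all non-empty trees. -/
def counit : H →ₐ[ℝ] ℝ := MvPolynomial.aeval fun _ => 0

/-- The elements of the Butcher group: characters of `H`. -/
abbrev Character : Type := H →ₐ[ℝ] ℝ

/-- The convolution product `φ₁ * φ₂ = μ ∘ (φ₁ ⊗ φ₂) ∘ Δ`. -/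
def conv (φ₁ φ₂ : Character) : Character :=
  (Algebra.TensorProduct.lmul' ℝ).comp ((Algebra.TensorProduct.map φ₁ φ₂).comp coproduct)

/-- The canonical involution `τ ↦ (-1)^|τ| τ` of `H`. -/
def involution : H →ₐ[ℝ] H :=
  MvPolynomial.aeval fun τ => (-1 : ℝ) ^ τ.size • (MvPolynomial.X τ : H)

/-- The involution induced on characters. -/
def bar (ζ : Character) : Character := ζ.comp involution

/-- A character `ζ` is odd if `bar ζ` is its inverse in the Butcher group. -/
def IsOdd (ζ : Character) : Prop := conv ζ (bar ζ) = counit ∧ conv (bar ζ) ζ = counit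

/-! ### Formal power series in the step size -/

section Formal

variable {E : Type*} [NormedAddCommGroup E] [NormedSpace ℝ E]

/-- Smoothness of the evaluation of a smooth family of multilinear maps on smooth families of
vectors. -/
theorem contDiff_multilinear_apply {V W : Type*} [NormedAddCommGroup V] [NormedSpace ℝ V]
    [NormedAddCommGroup W] [NormedSpace ℝ W] (n : ℕ) {M : E → V [×n]→L[ℝ] W}
    {v : Fin n → E → V} (hM : ContDiff ℝ ∞ M) (hv : ∀ i, ContDiff ℝ ∞ (v i)) :
    ContDiff ℝ ∞ fun y => M y fun i => v i y := by
  induction n with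
  | zero =>
    have : (fun y => M y fun i => v i y) =
        fun y => (continuousMultilinearCurryFin0 ℝ V W) (M y) := by
      funext y
      rw [continuousMultilinearCurryFin0_apply]
      congr 1
      exact Subsingleton.elim _ _
    rw [this]
    exact (continuousMultilinearCurryFin0 ℝ V W).contDiff.comp hM
  | succ n ih =>
    let I : (V [×(n + 1)]→L[ℝ] W) ≃ₗᵢ[ℝ] (V →L[ℝ] V [×n]→L[ℝ] W) :=
      continuousMultilinearCurryLeftEquiv ℝ (fun _ : Fin (n + 1) => V) W
    have hI : ContDiff ℝ ∞ fun L => I L := by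
      have : IsBoundedLinearMap ℝ fun L => I L :=
        IsLinearMap.with_bound ⟨fun x y => I.map_add x y, fun c x => I.map_smul c x⟩ 1
          fun x => by rw [one_mul]; exact (I.norm_map x).le
      exact this.contDiff
    have h1 : ContDiff ℝ ∞ fun y => I (M y) := hI.comp hM
    have h2 := ih (h1.clm_apply (hv 0)) (fun i => hv i.succ)
    convert h2 using 2 with y
    simp only [I, continuousMultilinearCurryLeftEquiv_apply]
    congr 1
    funext i
    refine Fin.cases ?_ (fun j => ?_) i <;> simp

/-- A formal one-step map `y ↦ y + ∑_{n ≥ 1} hⁿ cₙ(y)`: a formal power series in the step size `h`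
whose coefficients are smooth maps and which is the identity for `h = 0`. -/
@[ext]
structure FormalMap (E : Type*) [NormedAddCommGroup E] [NormedSpace ℝ E] where
  coeff : ℕ → E → E
  coeff_zero : coeff 0 = id
  smooth : ∀ n, ContDiff ℝ ∞ (coeff n)

namespace FormalMap

/-- The truncation `∑_{n ≤ k} hⁿ cₙ(y)`. -/
def trunc (Φ : FormalMap E) (k : ℕ) (h : ℝ) (y : E) : E :=
  ∑ n ∈ Finset.range (k + 1), h ^ n • Φ.coeff n y

theorem trunc_smooth (Φ : FormalMap E) (k : ℕ) :
    ContDiff ℝ ∞ fun p : ℝ × E => Φ.trunc k p.1 p.2 := by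
  unfold trunc
  exact ContDiff.sum fun n _ => (contDiff_fst.pow n).smul ((Φ.smooth n).comp contDiff_snd)

theorem iteratedDeriv_smooth (k : ℕ) {g : ℝ × E → E} (hg : ContDiff ℝ ∞ g) :
    ContDiff ℝ ∞ fun p : ℝ × E => iteratedDeriv k (fun h => g (h, p.2)) p.1 := by
  induction k with
  | zero => simpa [iteratedDeriv_zero] using hg
  | succ k ih =>
    have h1 : ContDiff ℝ ∞ (fderiv ℝ fun p : ℝ × E =>
        iteratedDeriv k (fun h => g (h, p.2)) p.1) := ih.fderiv_right (by simp)
    have h2 := h1.clm_apply (contDiff_const (c := ((1 : ℝ), (0 : E))))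
    convert h2 using 2 with p
    rw [iteratedDeriv_succ]
    have hd : HasDerivAt (fun h : ℝ => (h, p.2)) ((1 : ℝ), (0 : E)) p.1 :=
      (hasDerivAt_id p.1).prodMk (hasDerivAt_const p.1 p.2)
    have hF : HasFDerivAt (fun p : ℝ × E => iteratedDeriv k (fun h => g (h, p.2)) p.1)
        (fderiv ℝ (fun p : ℝ × E => iteratedDeriv k (fun h => g (h, p.2)) p.1) (p.1, p.2))
        (p.1, p.2) := (ih.differentiable (by simp) _).hasFDerivAt
    exact (hF.comp_hasDerivAt p.1 hd).deriv

/-- The identity map. -/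
def one : FormalMap E where
  coeff n := if n = 0 then id else 0
  coeff_zero := by simp
  smooth n := by
    split_ifs
    · exact contDiff_id
    · exact contDiff_const

/-- The composition `Ψ_h ∘ Φ_h` of formal maps: the coefficient of `h^k` is the `k`-th Taylor
coefficient at `h = 0` of `h ↦ Ψ_h(Φ_h(y))`, in which the terms of `Ψ` and `Φ` of order larger
than `k` play no role. -/
def comp (Ψ Φ : FormalMap E) : FormalMap E where
  coeff k y := ((k.factorial : ℝ)⁻¹) •
    iteratedDeriv k (fun h : ℝ => Ψ.trunc k h (Φ.trunc k h y)) 0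
  coeff_zero := by
    funext y
    simp [trunc, Ψ.coeff_zero, Φ.coeff_zero]
  smooth k := by
    have h1 : ContDiff ℝ ∞ fun p : ℝ × E => Ψ.trunc k p.1 (Φ.trunc k p.1 p.2) :=
      (Ψ.trunc_smooth k).comp (contDiff_fst.prodMk (Φ.trunc_smooth k))
    have h2 := (iteratedDeriv_smooth k h1).comp
      ((contDiff_const (c := (0 : ℝ))).prodMk (contDiff_id (E := E)))
    exact contDiff_const.smul h2

/-- The formal map `Φ_{-h}`. -/
def reverse (Φ : FormalMap E) : FormalMap E where
  coeff n y := (-1 : ℝ) ^ n • Φ.coeff n y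
  coeff_zero := by funext y; simp [Φ.coeff_zero]
  smooth n := contDiff_const.smul (Φ.smooth n)

/-- `X` is the adjoint of `Φ`, that is, `X_h` is the inverse of `Φ_{-h}`. -/
def IsAdjoint (Φ X : FormalMap E) : Prop :=
  X.comp Φ.reverse = one ∧ Φ.reverse.comp X = one

end FormalMap

/-! ### Elementary differentials -/

/-- Iterated directional derivatives. -/
def dirDeriv (f : E → E) : List E → E → E
  | [] => f
  | v :: l => fun y => fderiv ℝ (dirDeriv f l) y v

theorem dirDeriv_smooth {f : E → E} (hf : ContDiff ℝ ∞ f) (l : List E) :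
    ContDiff ℝ ∞ (dirDeriv f l) := by
  induction l with
  | nil => exact hf
  | cons v l ih => exact (ih.fderiv_right (by simp)).clm_apply contDiff_const

theorem dirDeriv_perm {f : E → E} (hf : ContDiff ℝ ∞ f) {l₁ l₂ : List E} (h : l₁.Perm l₂) :
    dirDeriv f l₁ = dirDeriv f l₂ := by
  induction h with
  | nil => rfl
  | cons x _ ih => simp only [dirDeriv, ih]
  | swap x y l =>
    funext z
    have hs := dirDeriv_smooth hf l
    have h1 : ∀ v, fderiv ℝ (fun y => fderiv ℝ (dirDeriv f l) y v) z =
        (fderiv ℝ (fderiv ℝ (dirDeriv f l)) z).flip v := by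
      intro v
      have hd : DifferentiableAt ℝ (fderiv ℝ (dirDeriv f l)) z :=
        (hs.fderiv_right (m := ∞) (by simp)).differentiable (by simp) z
      ext w
      rw [fderiv_clm_apply hd (differentiableAt_const v)]
      simp
    simp only [dirDeriv, h1, ContinuousLinearMap.flip_apply]
    exact (hs.contDiffAt.isSymmSndFDerivAt (by simpa using ENat.LEInfty.out)).eq y x
  | trans _ _ ih₁ ih₂ => exact ih₁.trans ih₂

/-- The value `f⁽ᵐ⁾(y)(v₁, …, vₘ)` of the `m`-th derivative of `f`. -/
def derivApply (f : E → E) (l : List E) (y : E) : E := iteratedFDeriv ℝ l.length f y l.get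

theorem derivApply_eq_dirDeriv {f : E → E} (hf : ContDiff ℝ ∞ f) (l : List E) :
    derivApply f l = dirDeriv f l := by
  induction l with
  | nil => funext y; simp [derivApply, dirDeriv]
  | cons v l ih =>
    funext y
    have hd : DifferentiableAt ℝ (iteratedFDeriv ℝ l.length f) y :=
      (hf.iteratedFDeriv_right (m := ∞) (by exact_mod_cast le_top)).differentiable (by simp) y
    have h1 : fderiv ℝ (derivApply f l) y v =
        fderiv ℝ (iteratedFDeriv ℝ l.length f) y v l.get := by
      have := hd.hasFDerivAt.continuousMultilinear_apply_const l.get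
      exact congrArg (fun L => L v) this.fderiv
    simp only [dirDeriv, ← ih, h1]
    simp only [derivApply, List.length_cons, iteratedFDeriv_succ_apply_left]
    rfl

mutual
/-- The elementary differential of a planar tree:
`F([τ₁, …, τₘ])(y) = f⁽ᵐ⁾(y)(F(τ₁)(y), …, F(τₘ)(y))`. -/
def PTree.elem (f : E → E) : PTree → E → E
  | .node ts => fun y => derivApply f (PTree.elemList f ts y) y
/-- The list of the elementary differentials of a list of planar trees. -/
def PTree.elemList (f : E → E) : List PTree → E → List E
  | [] => fun _ => []
  | t :: ts => fun y => PTree.elem f t y :: PTree.elemList f ts y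
end

theorem PTree.elemList_eq_map (f : E → E) (ts : List PTree) (y : E) :
    elemList f ts y = ts.map fun t => elem f t y := by
  induction ts with
  | nil => simp [elemList]
  | cons t ts ih => simp [elemList, ih]

theorem PTree.elem_step {f : E → E} (hf : ContDiff ℝ ∞ f) {s t : PTree} (h : Step s t) :
    elem f s = elem f t := by
  induction h with
  | swap l₁ a b l₂ =>
    funext y
    simp only [elem, elemList_eq_map, derivApply_eq_dirDeriv hf]
    exact congrFun (dirDeriv_perm hf (((List.Perm.swap b a l₂).append_left l₁).map _)) y
  | child l₁ a b l₂ _ ih =>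
    funext y
    simp only [elem, elemList_eq_map, List.map_append, List.map_cons, ih]

mutual
theorem PTree.elem_smooth {f : E → E} (hf : ContDiff ℝ ∞ f) :
    ∀ t : PTree, ContDiff ℝ ∞ (elem f t)
  | .node ts => by
    have h := contDiff_multilinear_apply ts.length
      (M := iteratedFDeriv ℝ ts.length f) (v := fun i => elem f (ts.get i))
      (hf.iteratedFDeriv_right (m := ∞) (by exact_mod_cast le_top))
      (fun i => PTree.elem_smooth_list hf ts _ (List.get_mem ts i))
    convert h using 2 with y
    simp only [elem, derivApply]
    have key : ∀ (n : ℕ) (hn : n = ts.length) (w : Fin n → E),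
        (∀ i, w i = elem f (ts.get (Fin.cast hn i)) y) →
        iteratedFDeriv ℝ n f y w =
          iteratedFDeriv ℝ ts.length f y fun i => elem f (ts.get i) y := by
      intro n hn w hw
      subst hn
      congr 1
      funext i
      exact hw i
    exact key _ (by simp [elemList_eq_map]) _ fun i => by simp [elemList_eq_map]
theorem PTree.elem_smooth_list {f : E → E} (hf : ContDiff ℝ ∞ f) :
    ∀ (ts : List PTree), ∀ t ∈ ts, ContDiff ℝ ∞ (elem f t)
  | [] => by simp
  | s :: ts => fun t ht => by
    rcases List.mem_cons.mp ht with h | h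
    · rw [h]
      exact PTree.elem_smooth hf s
    · exact PTree.elem_smooth_list hf ts t h
end

end Formal

/-! ### B-series methods -/

/-- Smooth vector fields on `ℝᴺ`. -/
structure VectorField (N : ℕ) where
  toFun : EuclideanSpace ℝ (Fin N) → EuclideanSpace ℝ (Fin N)
  smooth : ContDiff ℝ ∞ toFun

/-- The elementary differential `F(τ)` of a non-empty tree with respect to `f`. -/
def elemDiff {N : ℕ} (f : VectorField N) :
    RTree → EuclideanSpace ℝ (Fin N) → EuclideanSpace ℝ (Fin N) :=
  Quot.lift (PTree.elem f.toFun) fun _ _ => PTree.elem_step f.smooth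

theorem elemDiff_smooth {N : ℕ} (f : VectorField N) (τ : RTree) : ContDiff ℝ ∞ (elemDiff f τ) := by
  obtain ⟨t⟩ := τ
  exact PTree.elem_smooth f.smooth t

/-- A formal one-step method assigns to every smooth vector field `f` on some `ℝᴺ` a formal map
`Ψ_{h,f}` of `ℝᴺ`. -/
def Method : Type := ∀ N : ℕ, VectorField N → FormalMap (EuclideanSpace ℝ (Fin N))

/-- The composition `Ψ ∘ Φ` of methods. -/
def Method.comp (Ψ Φ : Method) : Method := fun N f => (Ψ N f).comp (Φ N f)

/-- The method `X` is the adjoint method of `Φ`, that is, `X_{h,f} = (Φ_{-h,f})⁻¹` for all `f`. -/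
def Method.IsAdjoint (Φ X : Method) : Prop := ∀ N f, (Φ N f).IsAdjoint (X N f)

/-- A method is symmetric if it is its own adjoint. -/
def Method.IsSymmetric (Φ : Method) : Prop := Φ.IsAdjoint Φ

/-- The B-series method with character `φ`,
`B_h(φ, f)(y) = y + ∑_τ h^|τ| φ(τ) / σ(τ) F(τ)(y)`, the sum being over the non-empty trees. -/
def bSeries (φ : Character) : Method := fun N f =>
  { coeff := fun n y =>
      if n = 0 then y
      else ∑ τ ∈ treesOfSize n, (φ (MvPolynomial.X τ) / (τ.sigma : ℝ)) • elemDiff f τ y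
    coeff_zero := by funext y; simp
    smooth := fun n => by
      by_cases hn : n = 0
      · simp only [hn, if_true]
        exact contDiff_id
      · simp only [hn, if_false]
        exact ContDiff.sum fun τ _ => (elemDiff_smooth f τ).const_smul _ }

end BSeries

end

noncomputable section

open scoped ContDiff

namespace BSeries

open Asymptotics Filter Topology

/-! ### The structure of the set of trees -/

-- The theorem is a statement about the Butcher group once two facts are known: composition of
-- B-series methods is convolution of characters, with the order reversed (`bSeries_comp`), and a
-- method determines its character (`bSeries_injective`). Since `bar` corresponds to `h ↦ -h`, a
-- method is symmetric exactly when its character is odd.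
--
-- In the group, the value of `χχ` at `τ` is `2χ(τ)` plus terms in smaller trees, so square roots
-- exist and are unique. The map `bar` is an automorphism because cuts preserve the number of
-- vertices. If `ψ` is odd and `χχ = ψ`, then `bar χ` and `χ⁻¹` are both square roots of `ψ⁻¹`,
-- hence equal; so the method of `χ` is its own adjoint and serves as `Ω`. Conversely, `Ω ∘ Ω*` has
-- the character `(bar ζ)⁻¹ ζ`, whose inverse `ζ⁻¹ (bar ζ)` is its image under `bar`.
--
-- Both facts on B-series rest on `exists_mem_eq_of_graft_mem`: a linear space of functions on trees
-- that is stable under `b ↦ graft b` takes all values on trees of bounded size. For composition,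
-- the space consists of the `b` for which substitution into the series of `b` is given by `cutSum`.
-- Grafting turns the increment `B(b)` into `h f(y + B(b))` (`bSum_graft_isBigO`), and `cutSum`
-- satisfies the matching identity `cutSum_graft`. For injectivity, the space consists of the
-- functions `τ ↦ ℓ(F(τ)(y))`, which is stable under grafting because an exponential component can
-- be added to the vector field. Formal series are handled throughout as truncations modulo
-- `O(h^(k+1))`, locally uniformly in the base point.

/-- The branches of the root of a tree. -/
def RTree.children : RTree → Multiset RTree :=
  Quot.lift (fun | .node ts => (ts.map RTree.mk : List RTree)) fun _ _ h => by
    cases h with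
    | swap l₁ a b l₂ => exact PTree.map_mk_swap l₁ a b l₂
    | child l₁ a b l₂ h => exact congrArg _ (PTree.map_mk_child l₁ l₂ h)

theorem RTree.children_mk (ts : List PTree) :
    (RTree.mk (.node ts)).children = (ts.map RTree.mk : List RTree) := rfl

theorem RTree.exists_list_map_mk (s : Multiset RTree) :
    ∃ ts : List PTree, s = (ts.map RTree.mk : List RTree) := by
  induction s using Quot.inductionOn with
  | h l => exact ⟨l.map RTree.rep, by simp [Function.comp_def, RTree.mk_rep]⟩

@[simp] theorem RTree.children_node (s : Multiset RTree) : (RTree.node s).children = s := by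
  obtain ⟨ts, rfl⟩ := RTree.exists_list_map_mk s
  rw [RTree.node_map_mk, RTree.children_mk]

@[simp] theorem RTree.node_children (τ : RTree) : RTree.node τ.children = τ := by
  obtain ⟨⟨ts⟩⟩ := τ
  exact RTree.node_map_mk ts

theorem RTree.node_injective : Function.Injective RTree.node :=
  Function.LeftInverse.injective RTree.children_node

theorem PTree.sizeList_eq_sum (ts : List PTree) :
    sizeList ts = (ts.map fun t => (RTree.mk t).size).sum := by
  induction ts with
  | nil => simp [sizeList]
  | cons t ts ih => simp only [sizeList, ih, List.map_cons, List.sum_cons]; rfl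

theorem PTree.sigmaList_eq_prod (ts : List PTree) :
    sigmaList ts = (ts.map fun t => (RTree.mk t).sigma).prod := by
  induction ts with
  | nil => simp [sigmaList]
  | cons t ts ih => simp only [sigmaList, ih, List.map_cons, List.prod_cons]; rfl

theorem RTree.size_node (s : Multiset RTree) :
    (RTree.node s).size = 1 + (s.map RTree.size).sum := by
  obtain ⟨ts, rfl⟩ := RTree.exists_list_map_mk s
  rw [RTree.node_map_mk]
  change PTree.size (.node ts) = _
  simp [PTree.size, PTree.sizeList_eq_sum, Function.comp_def]

theorem RTree.sigma_node (s : Multiset RTree) :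
    (RTree.node s).sigma = multFactorial s * (s.map RTree.sigma).prod := by
  obtain ⟨ts, rfl⟩ := RTree.exists_list_map_mk s
  rw [RTree.node_map_mk]
  change PTree.sigma (.node ts) = _
  simp [PTree.sigma, PTree.sigmaList_eq_prod, Function.comp_def]

theorem RTree.size_pos (τ : RTree) : 0 < τ.size := by
  rw [← τ.node_children, RTree.size_node]; omega

theorem RTree.size_lt_of_mem {s : Multiset RTree} {τ : RTree} (h : τ ∈ s) :
    τ.size < (RTree.node s).size := by
  have := Multiset.single_le_sum (s := s.map RTree.size) (fun _ _ => Nat.zero_le _) _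
    (Multiset.mem_map_of_mem _ h)
  rw [RTree.size_node]; omega

theorem RTree.size_induction {p : RTree → Prop}
    (h : ∀ τ : RTree, (∀ θ : RTree, θ.size < τ.size → p θ) → p τ) (τ : RTree) : p τ :=
  (measure RTree.size).wf.induction τ h

theorem RTree.sigma_ne_zero (τ : RTree) : τ.sigma ≠ 0 := by
  induction τ using RTree.size_induction with
  | h τ ih =>
    obtain ⟨s, rfl⟩ : ∃ s, τ = RTree.node s := ⟨_, τ.node_children.symm⟩
    rw [RTree.sigma_node]
    refine mul_ne_zero (Finset.prod_ne_zero_iff.mpr fun _ _ => Nat.factorial_ne_zero _) ?_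
    rw [Ne, Multiset.prod_eq_zero_iff]
    intro h0
    obtain ⟨θ, hθ, h0⟩ := Multiset.mem_map.mp h0
    exact ih θ (RTree.size_lt_of_mem hθ) h0

/-! ### Admissible cuts -/

theorem RTree.cuts_mk (t : PTree) : (RTree.mk t).cuts = t.cuts := rfl

mutual
theorem PTree.size_cuts : ∀ (t : PTree), ∀ c ∈ cuts t,
    (c.1.map RTree.size).sum + c.2.size = t.size
  | .node ts => by
    intro c hc
    rw [cuts, Multiset.mem_map] at hc
    obtain ⟨p, hp, rfl⟩ := hc
    have := PTree.size_childCuts ts p hp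
    simp only [RTree.size_node, size]
    omega
theorem PTree.size_childCuts : ∀ (ts : List PTree), ∀ p ∈ childCuts ts,
    (p.1.map RTree.size).sum + (p.2.map RTree.size).sum = sizeList ts
  | [] => by simp [childCuts, sizeList]
  | t :: ts => by
    intro c hc
    rw [childCuts, Multiset.mem_bind] at hc
    obtain ⟨p, hp, hc⟩ := hc
    have h1 := PTree.size_childCuts ts p hp
    rw [Multiset.mem_cons, Multiset.mem_map] at hc
    rcases hc with rfl | ⟨q, hq, rfl⟩
    · have : (RTree.mk t).size = t.size := rfl
      simp only [Multiset.map_cons, Multiset.sum_cons, sizeList]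
      omega
    · have := PTree.size_cuts t q hq
      simp only [Multiset.map_cons, Multiset.sum_cons, Multiset.map_add, Multiset.sum_add, sizeList]
      omega
end

mutual
-- Keeping every edge is the only way to prune nothing. All other cuts remove a vertex, so their
-- root components are strictly smaller, which is what recursions over trees need.
theorem PTree.exists_cuts_eq : ∀ t : PTree, ∃ R : Multiset (Multiset RTree × RTree),
    cuts t = (0, RTree.mk t) ::ₘ R ∧ ∀ c ∈ R, c.1 ≠ 0
  | .node ts => by
    obtain ⟨R, hR, h0⟩ := PTree.exists_childCuts_eq ts
    refine ⟨R.map fun p => (p.1, RTree.node p.2), ?_, ?_⟩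
    · rw [cuts, hR, Multiset.map_cons, RTree.node_map_mk]
    · intro c hc
      obtain ⟨p, hp, rfl⟩ := Multiset.mem_map.mp hc
      exact h0 p hp
theorem PTree.exists_childCuts_eq : ∀ ts : List PTree,
    ∃ R : Multiset (Multiset RTree × Multiset RTree),
    childCuts ts = ((0 : Multiset RTree), ((ts.map RTree.mk : List RTree) : Multiset RTree)) ::ₘ R ∧
      ∀ c ∈ R, c.1 ≠ 0
  | [] => ⟨0, by simp [childCuts], by simp⟩
  | t :: ts => by
    obtain ⟨R, hR, h0⟩ := PTree.exists_childCuts_eq ts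
    obtain ⟨R', hR', h0'⟩ := PTree.exists_cuts_eq t
    rw [childCuts, hR, Multiset.cons_bind, hR', Multiset.map_cons, Multiset.cons_swap]
    simp only [Multiset.cons_add, add_zero, Multiset.cons_coe, List.map_cons]
    refine ⟨_, rfl, ?_⟩
    intro c hc
    simp only [Multiset.mem_cons, Multiset.mem_add, Multiset.mem_map, Multiset.mem_bind] at hc
    rcases hc with rfl | ⟨q, hq, rfl⟩ | ⟨p, hp, rfl | ⟨q, _, rfl⟩⟩
    · simp
    · exact h0' q hq
    · simp
    · simp [h0 p hp]
end

theorem RTree.size_cuts {τ : RTree} {c : Multiset RTree × RTree} (hc : c ∈ τ.cuts) :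
    (c.1.map RTree.size).sum + c.2.size = τ.size := by
  obtain ⟨t⟩ := τ
  exact PTree.size_cuts t c hc

theorem RTree.size_snd_le {τ : RTree} {c : Multiset RTree × RTree} (hc : c ∈ τ.cuts) :
    c.2.size ≤ τ.size := by
  have := RTree.size_cuts hc; omega

theorem RTree.exists_cuts_eq (τ : RTree) : ∃ R : Multiset (Multiset RTree × RTree),
    τ.cuts = (0, τ) ::ₘ R ∧ ∀ c ∈ R, c.1 ≠ 0 := by
  obtain ⟨t⟩ := τ
  exact PTree.exists_cuts_eq t

/-- The admissible cuts that are neither empty nor total. -/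
def RTree.properCuts (τ : RTree) : Multiset (Multiset RTree × RTree) := τ.exists_cuts_eq.choose

theorem RTree.cuts_eq_cons (τ : RTree) : τ.cuts = (0, τ) ::ₘ τ.properCuts :=
  τ.exists_cuts_eq.choose_spec.1

theorem RTree.size_fst_lt {τ : RTree} {c : Multiset RTree × RTree} (hc : c ∈ τ.cuts) {θ : RTree}
    (hθ : θ ∈ c.1) : θ.size < τ.size := by
  have h1 := RTree.size_cuts hc
  have h2 := RTree.size_pos c.2
  have := Multiset.single_le_sum (s := c.1.map RTree.size) (fun _ _ => Nat.zero_le _) _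
    (Multiset.mem_map_of_mem _ hθ)
  omega

theorem RTree.mem_cuts_of_mem_properCuts {τ : RTree} {c : Multiset RTree × RTree}
    (hc : c ∈ τ.properCuts) : c ∈ τ.cuts := by
  rw [RTree.cuts_eq_cons]; exact Multiset.mem_cons_of_mem hc

theorem RTree.size_snd_lt {τ : RTree} {c : Multiset RTree × RTree} (hc : c ∈ τ.properCuts) :
    c.2.size < τ.size := by
  have h1 := RTree.size_cuts (RTree.mem_cuts_of_mem_properCuts hc)
  obtain ⟨θ, hθ⟩ := Multiset.exists_mem_of_ne_zero (τ.exists_cuts_eq.choose_spec.2 c hc)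
  have := Multiset.single_le_sum (s := c.1.map RTree.size) (fun _ _ => Nat.zero_le _) _
    (Multiset.mem_map_of_mem _ hθ)
  have := θ.size_pos
  omega

/-! ### Convolution in terms of cuts -/

/-- The function `[τ₁, …, τₘ] ↦ b(τ₁) ⋯ b(τₘ)` on trees. -/
def graft (b : RTree → ℝ) (τ : RTree) : ℝ := (τ.children.map b).prod

@[simp] theorem graft_node (b : RTree → ℝ) (s : Multiset RTree) :
    graft b (RTree.node s) = (s.map b).prod := by simp [graft]

/-- The function `τ ↦ ∑_c φ(P_c(τ)) b(R_c(τ))`, the sum being over all cuts but the total one. -/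
def cutSum (φ : Character) (b : RTree → ℝ) (τ : RTree) : ℝ :=
  (τ.cuts.map fun c => φ (forest c.1) * b c.2).sum

@[simp] theorem map_forest (φ : Character) (s : Multiset RTree) :
    φ (forest s) = (s.map fun τ => φ (MvPolynomial.X τ)).prod := by
  simp [forest, map_multiset_prod]

theorem conv_X (φ₁ φ₂ : Character) (τ : RTree) :
    conv φ₁ φ₂ (MvPolynomial.X τ) =
      φ₁ (MvPolynomial.X τ) + cutSum φ₁ (fun θ => φ₂ (MvPolynomial.X θ)) τ := by
  simp only [conv, coproduct, AlgHom.comp_apply, MvPolynomial.aeval_X, map_add,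
    map_multiset_sum, Multiset.map_map, Function.comp_def, Algebra.TensorProduct.map_tmul,
    Algebra.TensorProduct.lmul'_apply_tmul, map_one, mul_one, cutSum]

theorem cutSum_mk_node (φ : Character) (b : RTree → ℝ) (ts : List PTree) :
    cutSum φ (graft b) (RTree.mk (.node ts)) =
      ((PTree.childCuts ts).map fun p => φ (forest p.1) * (p.2.map b).prod).sum := by
  rw [cutSum, RTree.cuts_mk, PTree.cuts, Multiset.map_map]
  simp

/-- The choices at different branches are independent, so the sum factorises. A branch is either
pruned as a whole, with weight `φ`, or cut inside, with weight `cutSum φ b`. -/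
theorem sum_childCuts (φ : Character) (b : RTree → ℝ) (ts : List PTree) :
    ((PTree.childCuts ts).map fun p => φ (forest p.1) * (p.2.map b).prod).sum =
      (ts.map fun t => φ (MvPolynomial.X (RTree.mk t)) + cutSum φ b (RTree.mk t)).prod := by
  induction ts with
  | nil => simp [PTree.childCuts]
  | cons t ts ih =>
    rw [List.map_cons, List.prod_cons, ← ih, PTree.childCuts, Multiset.map_bind,
      Multiset.sum_bind, ← Multiset.sum_map_mul_left]
    refine congrArg _ (Multiset.map_congr rfl fun p _ => ?_)
    rw [Multiset.map_cons, Multiset.sum_cons, Multiset.map_map, add_mul, cutSum,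
      ← Multiset.sum_map_mul_right, RTree.cuts_mk]
    refine congrArg₂ _ (by simp; ring) (congrArg _ (Multiset.map_congr rfl fun q _ => ?_))
    simp only [map_forest, Function.comp_apply, Multiset.map_add, Multiset.prod_add,
      Multiset.map_cons, Multiset.prod_cons]
    ring

/-- The cocycle property of grafting with respect to the coproduct. The summand `φ (MvPolynomial.X
τ)` is the total cut of a branch, which `cutSum` leaves out. -/
theorem cutSum_graft (φ : Character) (b : RTree → ℝ) :
    cutSum φ (graft b) = graft fun τ => φ (MvPolynomial.X τ) + cutSum φ b τ := by
  funext τ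
  obtain ⟨⟨ts⟩⟩ := τ
  exact (cutSum_mk_node φ b ts).trans <| (sum_childCuts φ b ts).trans <| by
    simp only [graft]
    rw [show (Quot.mk PTree.Step (PTree.node ts) : RTree) = RTree.mk (.node ts) from rfl,
      RTree.children_mk]
    simp [Function.comp_def]

theorem cutSum_congr (φ : Character) {b b' : RTree → ℝ} {τ : RTree}
    (h : ∀ θ : RTree, θ.size ≤ τ.size → b θ = b' θ) : cutSum φ b τ = cutSum φ b' τ :=
  congrArg _ (Multiset.map_congr rfl fun _ hc => by rw [h _ (RTree.size_snd_le hc)])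

theorem cutSum_add (φ : Character) (b b' : RTree → ℝ) :
    cutSum φ (b + b') = cutSum φ b + cutSum φ b' := by
  funext τ
  simp [cutSum, mul_add, Multiset.sum_map_add]

theorem cutSum_smul (φ : Character) (r : ℝ) (b : RTree → ℝ) :
    cutSum φ (r • b) = r • cutSum φ b := by
  funext τ
  simp [cutSum, mul_left_comm, Multiset.sum_map_mul_left]

theorem cutSum_eq_add (φ : Character) (b : RTree → ℝ) (τ : RTree) :
    cutSum φ b τ = b τ + (τ.properCuts.map fun c => φ (forest c.1) * b c.2).sum := by
  rw [cutSum, RTree.cuts_eq_cons]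
  simp

theorem character_ext {φ φ' : Character}
    (h : ∀ τ, φ (MvPolynomial.X τ) = φ' (MvPolynomial.X τ)) : φ = φ' :=
  MvPolynomial.algHom_ext h

/-! ### Expansions in the step size -/

section Expansions

theorem tendsto_fst_nhds {X : Type*} [TopologicalSpace X] (y : X) :
    Tendsto (fun p : ℝ × X => p.1) (𝓝 (0, y)) (𝓝 0) :=
  continuous_fst.tendsto (0, y)

theorem tendsto_prodMk_const {X : Type*} [TopologicalSpace X] (y : X) :
    Tendsto (fun h : ℝ => (h, y)) (𝓝 0) (𝓝 (0, y)) := by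
  have : Continuous fun h : ℝ => (h, y) := by fun_prop
  exact this.tendsto 0

variable {E : Type*} [NormedAddCommGroup E] [NormedSpace ℝ E]

theorem taylor_isBigO {u : ℝ → E} (hu : ContDiff ℝ ∞ u) (k : ℕ) :
    (fun h => u h - ∑ n ∈ Finset.range (k + 1),
      h ^ n • ((n.factorial : ℝ)⁻¹ • iteratedDeriv n u 0)) =O[𝓝 0] fun h : ℝ => h ^ (k + 1) := by
  -- The expansion is taken one order too far: its remainder is `o(h^(k+1))`, and the extra term is
  -- `O(h^(k+1))`.
  have h1 := (taylor_isLittleO_univ (n := k + 1) (x₀ := (0 : ℝ))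
    (hu.of_le (by exact_mod_cast le_top))).isBigO
  simp only [taylor_within_apply, sub_zero, iteratedDerivWithin_univ] at h1
  have h2 : (fun h : ℝ => h ^ (k + 1) • ((((k + 1).factorial : ℝ)⁻¹ •
      iteratedDeriv (k + 1) u 0))) =O[𝓝 0] fun h : ℝ => h ^ (k + 1) := by
    refine IsBigO.of_bound ‖(((k + 1).factorial : ℝ)⁻¹ • iteratedDeriv (k + 1) u 0)‖
      (Eventually.of_forall fun h => ?_)
    rw [norm_smul, mul_comm]
  refine (h1.add h2).congr_left fun h => ?_
  rw [Finset.sum_range_succ _ (k + 1)]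
  simp only [smul_smul, mul_comm]
  abel

theorem coeff_eq_zero_of_isBigO (k : ℕ) (c : ℕ → E)
    (h : (fun h : ℝ => ∑ n ∈ Finset.range (k + 1), h ^ n • c n) =O[𝓝[≠] 0]
      fun h : ℝ => h ^ (k + 1)) : ∀ n ≤ k, c n = 0 := by
  induction k generalizing c with
  | zero =>
    intro n hn
    obtain rfl : n = 0 := by omega
    have h0 : Tendsto (fun h : ℝ => h ^ (0 + 1)) (𝓝[≠] 0) (𝓝 0) := by
      have : Tendsto (fun h : ℝ => h ^ (0 + 1)) (𝓝 0) (𝓝 (0 ^ (0 + 1))) :=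
        (continuous_pow _).tendsto 0
      simpa using this.mono_left nhdsWithin_le_nhds
    have h1 := h.trans_tendsto h0
    simp only [zero_add, Finset.range_one, Finset.sum_singleton, pow_zero, one_smul] at h1
    exact tendsto_nhds_unique tendsto_const_nhds h1
  | succ k ih =>
    have hc0 : c 0 = 0 := by
      have h0 : Tendsto (fun h : ℝ => h ^ (k + 1 + 1)) (𝓝[≠] 0) (𝓝 0) := by
        have : Tendsto (fun h : ℝ => h ^ (k + 1 + 1)) (𝓝 0) (𝓝 (0 ^ (k + 1 + 1))) :=
          (continuous_pow _).tendsto 0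
        simpa using this.mono_left nhdsWithin_le_nhds
      have h1 := h.trans_tendsto h0
      have h2 : Tendsto (fun h : ℝ => ∑ n ∈ Finset.range (k + 1 + 1), h ^ n • c n) (𝓝[≠] 0)
          (𝓝 (∑ n ∈ Finset.range (k + 1 + 1), (0 : ℝ) ^ n • c n)) := by
        have : Continuous (fun h : ℝ => ∑ n ∈ Finset.range (k + 1 + 1), h ^ n • c n) := by
          fun_prop
        exact (this.tendsto 0).mono_left nhdsWithin_le_nhds
      have h3 := tendsto_nhds_unique h2 h1
      rw [Finset.sum_range_succ'] at h3
      simpa using h3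
    have key := ih (fun n => c (n + 1)) ?_
    · intro n hn
      cases n with
      | zero => exact hc0
      | succ n => exact key n (by omega)
    -- With `c 0 = 0` the estimate can be divided by `h`; this is why the neighbourhood is
    -- punctured.
    · obtain ⟨C, hC⟩ := h.bound
      refine IsBigO.of_bound C ?_
      filter_upwards [hC, self_mem_nhdsWithin] with h hh hne
      have hpos : 0 < ‖h‖ := norm_pos_iff.mpr hne
      rw [Finset.sum_range_succ', hc0, smul_zero, add_zero] at hh
      have : ∑ n ∈ Finset.range (k + 1), h ^ (n + 1) • c (n + 1) =
          h • ∑ n ∈ Finset.range (k + 1), h ^ n • c (n + 1) := by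
        rw [Finset.smul_sum]
        exact Finset.sum_congr rfl fun n _ => by rw [smul_smul, pow_succ']
      rw [this, norm_smul, pow_succ' h (k + 1), norm_mul, ← mul_assoc, mul_comm C, mul_assoc] at hh
      exact le_of_mul_le_mul_left hh hpos

theorem iteratedDeriv_eq_zero_of_isBigO {u : ℝ → E} (hu : ContDiff ℝ ∞ u) {k : ℕ}
    (h : u =O[𝓝 0] fun h : ℝ => h ^ (k + 1)) : ∀ n ≤ k, iteratedDeriv n u 0 = 0 := by
  intro n hn
  have h1 := (h.sub (taylor_isBigO hu k)).mono (nhdsWithin_le_nhds (s := {0}ᶜ))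
  simp only [sub_sub_cancel] at h1
  have := coeff_eq_zero_of_isBigO k _ h1 n hn
  exact (smul_eq_zero.mp this).resolve_left (by positivity)

/-- A smooth function of `(h, z)` all of whose `h`-derivatives of order less than `m` vanish at
`h = 0` is `O(hᵐ)`, locally uniformly in `z`. -/
theorem isBigO_of_iteratedDeriv_eq_zero (m : ℕ) {g : ℝ × E → E} (hg : ContDiff ℝ ∞ g)
    (h0 : ∀ j < m, ∀ z, iteratedDeriv j (fun h => g (h, z)) 0 = 0) (y : E) :
    g =O[𝓝 (0, y)] fun p => p.1 ^ m := by
  induction m generalizing g with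
  | zero =>
    simp only [pow_zero]
    exact (hg.continuous.tendsto (0, y)).isBigO_one ℝ
  | succ m ih =>
    have hsm := FormalMap.iteratedDeriv_smooth 1 hg
    simp only [iteratedDeriv_one] at hsm
    have h1 := ih hsm (fun j hj z => by
      have := h0 (j + 1) (by omega) z
      rwa [iteratedDeriv_succ'] at this)
    obtain ⟨C, hCpos, hC⟩ := h1.exists_pos
    obtain ⟨δ, hδ, hball⟩ := Metric.eventually_nhds_iff_ball.mp hC.bound
    refine IsBigO.of_bound C (Metric.eventually_nhds_iff_ball.mpr ⟨δ, hδ, ?_⟩)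
    rintro ⟨h, z⟩ hp
    rw [← ball_prod_same, Set.mem_prod] at hp
    have hz0 : g (0, z) = 0 := by simpa using h0 0 (by omega) z
    have hd : Differentiable ℝ fun t => g (t, z) :=
      (hg.comp (contDiff_id.prodMk contDiff_const)).differentiable (by simp)
    -- The points `(t, z)` with `‖t‖ ≤ ‖h‖` stay in the same ball, so the mean value inequality
    -- gains a factor `‖h‖` with a constant independent of `z`.
    have hle := (convex_closedBall (0 : ℝ) ‖h‖).norm_image_sub_le_of_norm_deriv_le
      (f := fun t => g (t, z)) (C := C * ‖h‖ ^ m) (fun t _ => hd t)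
      (fun t ht => by
        have ht' : ‖t‖ ≤ ‖h‖ := by simpa using ht
        have hmem : (t, z) ∈ Metric.ball ((0 : ℝ), y) δ := by
          rw [← ball_prod_same, Set.mem_prod]
          refine ⟨?_, hp.2⟩
          have := hp.1
          simp only [Metric.mem_ball, dist_zero_right] at this ⊢
          exact ht'.trans_lt this
        refine (hball (t, z) hmem).trans ?_
        simp only [norm_pow]
        gcongr)
      (x := 0) (y := h) (by simp) (by simp)
    simp only [hz0, sub_zero] at hle
    simpa [pow_succ, mul_assoc] using hle

/-- For smooth functions of `(h, z)`, the estimate `O(h^(k+1))` for every fixed `z` is locally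
uniform in `z`. -/
theorem isBigO_of_forall_isBigO {g : ℝ × E → E} (hg : ContDiff ℝ ∞ g) {k : ℕ}
    (h : ∀ z, (fun h => g (h, z)) =O[𝓝 0] fun h : ℝ => h ^ (k + 1)) (y : E) :
    g =O[𝓝 (0, y)] fun p => p.1 ^ (k + 1) :=
  isBigO_of_iteratedDeriv_eq_zero (k + 1) hg (fun j hj z =>
    iteratedDeriv_eq_zero_of_isBigO (hg.comp (contDiff_id.prodMk contDiff_const)) (h z) j
      (by omega)) y

/-- A smooth map is locally Lipschitz, so an error in the inner map is carried through the outer one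
without loss of order. -/
theorem isBigO_comp_sub {F α : Type*} [NormedAddCommGroup F] [NormedSpace ℝ F] {l : Filter α}
    {A : ℝ × E → F} (hA : ContDiff ℝ ∞ A) {η : α → ℝ} {u v : α → E} {y : E}
    (hη : Tendsto η l (𝓝 0)) (hu : Tendsto u l (𝓝 y)) (hv : Tendsto v l (𝓝 y)) :
    (fun a => A (η a, u a) - A (η a, v a)) =O[l] fun a => u a - v a := by
  obtain ⟨K, t, ht, hK⟩ :=
    (hA.contDiffAt (x := (0, y)) |>.of_le (m := 1) (by simp)).exists_lipschitzOnWith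
  refine IsBigO.of_bound K ?_
  filter_upwards [(hη.prodMk_nhds hu).eventually ht, (hη.prodMk_nhds hv).eventually ht]
    with a h1 h2
  have := hK.norm_sub_le h1 h2
  simpa using this

end Expansions

-- Formal maps form a monoid under composition

namespace FormalMap

variable {E : Type*} [NormedAddCommGroup E] [NormedSpace ℝ E]

theorem trunc_zero (A : FormalMap E) (k : ℕ) (y : E) : A.trunc k 0 y = y := by
  rw [trunc, Finset.sum_range_succ']
  simp [A.coeff_zero]

theorem tendsto_trunc (A : FormalMap E) (k : ℕ) (y : E) :
    Tendsto (fun p : ℝ × E => A.trunc k p.1 p.2) (𝓝 (0, y)) (𝓝 y) := by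
  have := (A.trunc_smooth k).continuous.tendsto (0, y)
  simpa only [trunc_zero] using this

theorem tendsto_trunc_prodMk (A : FormalMap E) (k : ℕ) (y : E) :
    Tendsto (fun p : ℝ × E => (p.1, A.trunc k p.1 p.2)) (𝓝 (0, y)) (𝓝 (0, y)) :=
  (tendsto_fst_nhds y).prodMk_nhds (A.tendsto_trunc k y)

theorem comp_trunc_smooth (A B : FormalMap E) (j k : ℕ) :
    ContDiff ℝ ∞ fun p : ℝ × E => A.trunc j p.1 (B.trunc k p.1 p.2) :=
  (A.trunc_smooth j).comp (contDiff_fst.prodMk (B.trunc_smooth k))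

theorem trunc_sub_trunc_isBigO (A : FormalMap E) {n k : ℕ} (hnk : n ≤ k) (y : E) :
    (fun p : ℝ × E => A.trunc k p.1 p.2 - A.trunc n p.1 p.2) =O[𝓝 (0, y)]
      fun p => p.1 ^ (n + 1) := by
  have h1 : (fun p : ℝ × E => A.trunc k p.1 p.2 - A.trunc n p.1 p.2) =
      fun p => ∑ j ∈ Finset.Ico (n + 1) (k + 1), p.1 ^ j • A.coeff j p.2 := by
    funext p
    rw [trunc, trunc, Finset.sum_Ico_eq_sub _ (by omega)]
  rw [h1]
  refine IsBigO.fun_sum fun j hj => ?_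
  have hj' : n + 1 ≤ j := (Finset.mem_Ico.mp hj).1
  have hb : (fun p : ℝ × E => p.1 ^ (j - (n + 1)) • A.coeff j p.2) =O[𝓝 (0, y)]
      fun _ => (1 : ℝ) := by
    have : Continuous fun p : ℝ × E => p.1 ^ (j - (n + 1)) • A.coeff j p.2 :=
      (continuous_fst.pow _).smul ((A.smooth j).continuous.comp continuous_snd)
    exact (this.tendsto (0, y)).isBigO_one ℝ
  refine ((isBigO_refl (fun p : ℝ × E => p.1 ^ (n + 1)) _).smul hb).congr (fun p => ?_)
    fun p => by simp
  rw [smul_smul, ← pow_add, Nat.add_sub_cancel' hj']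

theorem comp_trunc_sub_isBigO (A B : FormalMap E) {n k : ℕ} (hnk : n ≤ k) (y : E) :
    (fun p : ℝ × E => A.trunc k p.1 (B.trunc k p.1 p.2) - A.trunc n p.1 (B.trunc n p.1 p.2))
      =O[𝓝 (0, y)] fun p => p.1 ^ (n + 1) := by
  have h1 := (A.trunc_sub_trunc_isBigO hnk y).comp_tendsto (B.tendsto_trunc_prodMk k y)
  have h2 := (isBigO_comp_sub (A.trunc_smooth n) (tendsto_fst_nhds y) (B.tendsto_trunc k y)
    (B.tendsto_trunc n y)).trans (B.trunc_sub_trunc_isBigO hnk y)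
  refine (h1.add h2).congr (fun p => ?_) fun p => rfl
  simp

/-- The truncations of a composition are the compositions of the truncations, up to terms of
higher order. -/
theorem trunc_comp_isBigO (A B : FormalMap E) (k : ℕ) (y : E) :
    (fun p : ℝ × E => (A.comp B).trunc k p.1 p.2 - A.trunc k p.1 (B.trunc k p.1 p.2))
      =O[𝓝 (0, y)] fun p => p.1 ^ (k + 1) := by
  refine isBigO_of_forall_isBigO (((A.comp B).trunc_smooth k).sub (A.comp_trunc_smooth B k k))
    (fun z => ?_) y
  have hs : ∀ n, ContDiff ℝ ∞ fun h : ℝ => A.trunc n h (B.trunc n h z) := fun n =>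
    (A.comp_trunc_smooth B n n).comp (contDiff_id.prodMk contDiff_const)
  -- The coefficient of order `n` is defined with truncations at `n`. Truncating at `k` changes the
  -- composite by `O(h^(n+1))`, which the `n`-th derivative at `0` does not see.
  have hcoef : ∀ n ≤ k, iteratedDeriv n (fun h : ℝ => A.trunc n h (B.trunc n h z)) 0 =
      iteratedDeriv n (fun h : ℝ => A.trunc k h (B.trunc k h z)) 0 := by
    intro n hn
    have h1 := (A.comp_trunc_sub_isBigO B hn z).comp_tendsto (tendsto_prodMk_const z)
    have h2 := iteratedDeriv_eq_zero_of_isBigO ((hs k).sub (hs n)) h1 n le_rfl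
    rw [iteratedDeriv_fun_sub ((hs k).contDiffAt.of_le (by exact_mod_cast le_top))
      ((hs n).contDiffAt.of_le (by exact_mod_cast le_top)), sub_eq_zero] at h2
    exact h2.symm
  refine ((taylor_isBigO (hs k) k).neg_left).congr_left fun h => ?_
  rw [neg_sub]
  refine congrArg (· - _) (Finset.sum_congr rfl fun n hn => ?_)
  rw [← hcoef n (by simpa [Nat.lt_succ_iff] using hn)]
  rfl

theorem eq_of_isBigO {A B : FormalMap E}
    (h : ∀ k y, (fun p : ℝ × E => A.trunc k p.1 p.2 - B.trunc k p.1 p.2)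
      =O[𝓝 (0, y)] fun p => p.1 ^ (k + 1)) : A = B := by
  ext k y
  have h1 := ((h k y).comp_tendsto (tendsto_prodMk_const y)).mono
    (nhdsWithin_le_nhds (s := {0}ᶜ))
  have h2 := coeff_eq_zero_of_isBigO k (fun n => A.coeff n y - B.coeff n y)
    (h1.congr_left fun h => by simp [trunc, smul_sub]) k le_rfl
  exact sub_eq_zero.mp h2

theorem comp_eq_of_isBigO {A B C : FormalMap E}
    (h : ∀ k y, (fun p : ℝ × E => A.trunc k p.1 (B.trunc k p.1 p.2) - C.trunc k p.1 p.2)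
      =O[𝓝 (0, y)] fun p => p.1 ^ (k + 1)) : A.comp B = C :=
  eq_of_isBigO fun k y => ((A.trunc_comp_isBigO B k y).add (h k y)).congr_left fun p => by simp

/-- Associativity is literal for truncations. Local uniformity allows the estimate for `A` and `B`
to be used at the moving point `C.trunc k p.1 p.2`. -/
theorem comp_assoc (A B C : FormalMap E) : (A.comp B).comp C = A.comp (B.comp C) := by
  refine comp_eq_of_isBigO fun k y => ?_
  have h1 := (A.trunc_comp_isBigO B k y).comp_tendsto (C.tendsto_trunc_prodMk k y)
  have hBC : Tendsto (fun p : ℝ × E => B.trunc k p.1 (C.trunc k p.1 p.2)) (𝓝 (0, y)) (𝓝 y) :=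
    (B.tendsto_trunc k y).comp (C.tendsto_trunc_prodMk k y)
  have h2 := (isBigO_comp_sub (A.trunc_smooth k) (tendsto_fst_nhds y)
    ((B.comp C).tendsto_trunc k y) hBC).trans (B.trunc_comp_isBigO C k y)
  have h3 := A.trunc_comp_isBigO (B.comp C) k y
  refine ((h1.sub h2).sub h3).congr_left fun p => ?_
  simp

theorem trunc_one (k : ℕ) (h : ℝ) (y : E) : (one : FormalMap E).trunc k h y = y := by
  rw [trunc, Finset.sum_range_succ']
  simp [one]

theorem one_comp (A : FormalMap E) : one.comp A = A :=
  comp_eq_of_isBigO fun k y => by simpa [trunc_one] using isBigO_zero _ _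

theorem comp_one (A : FormalMap E) : A.comp one = A :=
  comp_eq_of_isBigO fun k y => by simpa [trunc_one] using isBigO_zero _ _

end FormalMap

/-! ### Function spaces on trees that are closed under grafting -/

open Classical in
/-- The finite set of trees with at most `k` vertices. -/
def treesUpTo (k : ℕ) : Finset RTree := (Finset.range (k + 1)).biUnion treesOfSize

@[simp] theorem mem_treesOfSize {n : ℕ} {τ : RTree} : τ ∈ treesOfSize n ↔ τ.size = n := by
  simp [treesOfSize]

@[simp] theorem mem_treesUpTo {k : ℕ} {τ : RTree} : τ ∈ treesUpTo k ↔ τ.size ≤ k := by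
  simp [treesUpTo]

theorem sum_treesUpTo {M : Type*} [AddCommMonoid M] (k : ℕ) (g : RTree → M) :
    ∑ τ ∈ treesUpTo k, g τ = ∑ n ∈ Finset.range (k + 1), ∑ τ ∈ treesOfSize n, g τ := by
  classical
  rw [treesUpTo, Finset.sum_biUnion]
  intro m _ n _ hmn
  rw [Function.onFun, Finset.disjoint_left]
  intro τ h1 h2
  exact hmn ((mem_treesOfSize.mp h1).symm.trans (mem_treesOfSize.mp h2))

open Classical in
theorem forest_eq_monomial (s : Multiset RTree) :
    forest s = MvPolynomial.monomial (Multiset.toFinsupp s) 1 := by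
  induction s using Multiset.induction with
  | empty => simp [forest]
  | cons a s ih =>
    have : forest (a ::ₘ s) = MvPolynomial.X a * forest s := by simp [forest]
    rw [this, ih, ← Multiset.singleton_add, map_add, Multiset.toFinsupp_singleton,
      MvPolynomial.X, MvPolynomial.monomial_mul, one_mul]

theorem graft_congr {b b' : RTree → ℝ} {τ : RTree}
    (h : ∀ θ : RTree, θ.size < τ.size → b θ = b' θ) : graft b τ = graft b' τ := by
  obtain ⟨s, rfl⟩ : ∃ s, τ = RTree.node s := ⟨_, τ.node_children.symm⟩
  simp only [graft_node]
  exact congrArg _ (Multiset.map_congr rfl fun θ hθ => h θ (RTree.size_lt_of_mem hθ))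

/-- A space of functions on trees that is closed under grafting contains, for every `k`, functions
with arbitrarily prescribed values on the trees with at most `k` vertices. -/
theorem exists_mem_eq_of_graft_mem (W : Submodule ℝ (RTree → ℝ)) (hW : ∀ b ∈ W, graft b ∈ W)
    (k : ℕ) (a : RTree → ℝ) : ∃ w ∈ W, ∀ τ : RTree, τ.size ≤ k → w τ = a τ := by
  classical
  induction k generalizing a with
  | zero => exact ⟨0, W.zero_mem, fun τ hτ => by have := τ.size_pos; omega⟩
  | succ k ih =>
    let ρ : (RTree → ℝ) →ₗ[ℝ] (treesUpTo (k + 1) → ℝ) := LinearMap.funLeft ℝ ℝ Subtype.val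
    suffices htop : W.map ρ = ⊤ by
      obtain ⟨w, hw, hwa⟩ := (Submodule.mem_map (p := W)).mp (htop ▸ Submodule.mem_top (x := ρ a))
      exact ⟨w, hw, fun τ hτ => congrFun hwa ⟨τ, mem_treesUpTo.mpr hτ⟩⟩
    by_contra hne
    obtain ⟨f, hf0, hf⟩ := Submodule.exists_le_ker_of_lt_top _ (lt_top_iff_ne_top.mpr hne)
    have hfx : ∀ x, f x = ∑ τ, x τ * f (Pi.single τ 1) := fun x => by
      conv_lhs => rw [pi_eq_sum_univ' x]
      simp
    -- A functional that vanishes on all restrictions of grafted functions becomes a polynomial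
    -- relation among the forests of branches. Branches have at most `k` vertices, so by induction
    -- `P` vanishes at every point `x`.
    let P : H := ∑ τ : treesUpTo (k + 1), f (Pi.single τ 1) • forest τ.1.children
    have hP : P = 0 := by
      refine MvPolynomial.funext fun x => ?_
      obtain ⟨w, hw, hwx⟩ := ih x
      have h1 : f (ρ (graft w)) = 0 := hf (Submodule.mem_map_of_mem (hW w hw))
      rw [hfx] at h1
      rw [map_zero, ← h1, map_sum]
      refine Finset.sum_congr rfl fun τ _ => ?_
      have h2 : ρ (graft w) τ = graft x τ.1 :=
        graft_congr fun θ hθ => hwx θ (by have := mem_treesUpTo.mp τ.2; omega)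
      rw [h2, MvPolynomial.smul_eval, mul_comm]
      simp [forest, graft, map_multiset_prod]
    apply hf0
    -- A tree is determined by its branches, so distinct trees give distinct monomials in `P`.
    have hcoef : ∀ τ, f (Pi.single τ 1) = 0 := by
      intro τ
      have h1 := congrArg (MvPolynomial.coeff (Multiset.toFinsupp τ.1.children)) hP
      simp only [P, MvPolynomial.coeff_sum, MvPolynomial.coeff_smul, forest_eq_monomial,
        MvPolynomial.coeff_monomial, MvPolynomial.coeff_zero] at h1
      rw [Finset.sum_eq_single τ] at h1
      · simpa using h1
      · intro θ _ hθ
        rw [if_neg, smul_zero]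
        intro h
        have h2 := Multiset.toFinsupp.injective h
        exact hθ (Subtype.ext (by rw [← θ.1.node_children, h2, RTree.node_children]))
      · simp
    ext τ
    simpa using hcoef τ

/-! ### Taylor expansion of a vector field along a B-series -/

section Taylor

variable {E F : Type*} [NormedAddCommGroup E] [NormedSpace ℝ E] [NormedAddCommGroup F]
  [NormedSpace ℝ F] [CompleteSpace F]

theorem taylor_add_isBigO {f : E → F} (hf : ContDiff ℝ ∞ f) (x : E) (n : ℕ) :
    (fun v => f (x + v) - ∑ m ∈ Finset.range (n + 1),
      (m.factorial : ℝ)⁻¹ • iteratedFDeriv ℝ m f x fun _ => v) =O[𝓝 0] fun v => ‖v‖ ^ (n + 1) := by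
  have hcont : Continuous (iteratedFDeriv ℝ (n + 1) f) :=
    hf.continuous_iteratedFDeriv (by exact_mod_cast le_top)
  obtain ⟨C, hC, hb⟩ := ((hcont.tendsto x).isBigO_one ℝ).exists_pos
  obtain ⟨δ, hδ, hball⟩ := Metric.eventually_nhds_iff_ball.mp hb.bound
  refine IsBigO.of_bound (((n.factorial : ℝ)⁻¹) * C)
    (Metric.eventually_nhds_iff_ball.mpr ⟨δ, hδ, fun v hv => ?_⟩)
  rw [mem_ball_zero_iff] at hv
  rw [map_add_eq_sum_add_integral_iteratedFDeriv (n := n)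
    (fun t _ => hf.contDiffAt.of_le (by exact_mod_cast le_top)), add_sub_cancel_left, norm_smul,
    norm_inv, Real.norm_natCast, norm_pow, norm_norm, mul_assoc]
  gcongr
  have := intervalIntegral.norm_integral_le_of_norm_le_const (a := (0 : ℝ)) (b := 1)
    (C := C * ‖v‖ ^ (n + 1))
    (f := fun t : ℝ => (1 - t) ^ n • iteratedFDeriv ℝ (n + 1) f (x + t • v) fun _ => v) ?_
  · simpa using this
  · intro t ht
    rw [Set.uIoc_of_le zero_le_one] at ht
    have h1 : ‖(1 - t) ^ n‖ ≤ 1 := by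
      rw [norm_pow]
      refine pow_le_one₀ (norm_nonneg _) ?_
      rw [Real.norm_eq_abs, abs_le]
      constructor <;> linarith [ht.1, ht.2]
    have h2 : x + t • v ∈ Metric.ball x δ := by
      rw [mem_ball_iff_norm, add_sub_cancel_left, norm_smul, Real.norm_eq_abs, abs_of_pos ht.1]
      nlinarith [norm_nonneg v, ht.2]
    have h3 := hball _ h2
    rw [norm_one, mul_one] at h3
    rw [norm_smul]
    calc _ ≤ 1 * (‖iteratedFDeriv ℝ (n + 1) f (x + t • v)‖ * ∏ _i : Fin (n + 1), ‖v‖) := by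
          gcongr
          exact ContinuousMultilinearMap.le_opNorm _ _
      _ ≤ _ := by
          rw [one_mul, Finset.prod_const, Finset.card_univ, Fintype.card_fin]
          gcongr

end Taylor

/-- Expansion of a sum over all maps `Fin m → S` whose terms depend only on the multiset of
values. -/
theorem sum_piFinset_eq_sum_sym {E : Type*} [AddCommGroup E] [Module ℝ E] [DecidableEq RTree]
    (S : Finset RTree) (m : ℕ) (G : Multiset RTree → E) :
    ∑ r ∈ Fintype.piFinset fun _ : Fin m => S, G (Finset.univ.val.map r) =
      ∑ s ∈ S.sym m, (s.val.countPerms : ℝ) • G s.val := by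
  -- Two expansions of `(∑ τ ∈ S, X τ) ^ m` in `H`, over tuples and over multisets, are compared by
  -- the linear map that sends each forest `s` to `G s`.
  let Λ : H →ₗ[ℝ] E := (MvPolynomial.basisMonomials RTree ℝ).constr ℝ
    fun d => G (Finsupp.toMultiset d)
  have hΛ : ∀ s, Λ (forest s) = G s := fun s => by
    have h1 : forest s = MvPolynomial.basisMonomials RTree ℝ (Multiset.toFinsupp s) := by
      rw [forest_eq_monomial, MvPolynomial.coe_basisMonomials]
      congr!
    rw [h1, Module.Basis.constr_basis, Multiset.toFinsupp_toMultiset]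
  have h := (Finset.sum_pow' S (fun τ => (MvPolynomial.X τ : H)) m).symm.trans
    (Finset.sum_pow (s := S) (fun τ => (MvPolynomial.X τ : H)) m)
  have h2 := congrArg Λ h
  rw [map_sum, map_sum] at h2
  convert h2 using 1
  · refine Finset.sum_congr rfl fun r _ => ?_
    rw [← hΛ, forest, Multiset.map_map]
    rfl
  · refine Finset.sum_congr rfl fun s _ => ?_
    rw [← nsmul_eq_mul, map_nsmul, ← hΛ, forest, Nat.cast_smul_eq_nsmul]

/-- The Taylor factor `1/m!` times the number of orderings of the branches leaves the part of `1/σ`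
that is due to repeated branches. -/
theorem inv_factorial_mul_countPerms [DecidableEq RTree] (s : Multiset RTree) :
    ((s.card.factorial : ℝ))⁻¹ * (s.countPerms : ℝ) = (multFactorial s : ℝ)⁻¹ := by
  have h : multFactorial s * s.countPerms = s.card.factorial := by
    have h1 := Nat.multinomial_spec s.toFinset fun τ => s.count τ
    rw [Multiset.toFinset_sum_count_eq] at h1
    rw [← h1]
    refine congrArg₂ (· * ·) ?_ ?_
    · unfold multFactorial
      congr!
    · rw [Multiset.countPerms, Finsupp.multinomial_eq]
      simp only [Multiset.toFinsupp_support]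
      exact Nat.multinomial_congr fun τ _ => by simp
  have h0 : (multFactorial s : ℝ) ≠ 0 := by
    exact_mod_cast fun h0 => s.card.factorial_ne_zero (by rw [← h, h0, zero_mul])
  have h1 : ((s.card.factorial : ℝ)) ≠ 0 := by exact_mod_cast s.card.factorial_ne_zero
  have h2 : (multFactorial s : ℝ) * s.countPerms = s.card.factorial := by exact_mod_cast h
  rw [← h2] at h1 ⊢
  field_simp
  rw [div_self (right_ne_zero_of_mul h1)]

theorem derivApply_ofFn {E : Type*} [NormedAddCommGroup E] [NormedSpace ℝ E] (f : E → E) {m : ℕ}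
    (v : Fin m → E) (y : E) : derivApply f (List.ofFn v) y = iteratedFDeriv ℝ m f y v := by
  have key : ∀ (n : ℕ) (hn : n = m) (w : Fin n → E), (∀ i, w i = v (Fin.cast hn i)) →
      iteratedFDeriv ℝ n f y w = iteratedFDeriv ℝ m f y v := by
    intro n hn w hw
    subst hn
    exact congrArg _ (funext hw)
  exact key _ (List.length_ofFn) _ fun i => by simp [Fin.cast]

variable {N : ℕ} (f : VectorField N)

theorem elemDiff_mk (t : PTree) : elemDiff f (RTree.mk t) = PTree.elem f.toFun t := rfl

theorem elemDiff_node_map {m : ℕ} (r : Fin m → RTree) (y : EuclideanSpace ℝ (Fin N)) :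
    elemDiff f (RTree.node (Finset.univ.val.map r)) y =
      iteratedFDeriv ℝ m f.toFun y fun i => elemDiff f (r i) y := by
  have h1 : (Finset.univ.val.map r : Multiset RTree) =
      ((List.ofFn fun i => (r i).rep).map RTree.mk : List RTree) := by
    rw [List.map_ofFn, Fin.univ_val_map]
    simp [Function.comp_def, RTree.mk_rep]
  rw [h1, RTree.node_map_mk, elemDiff_mk, PTree.elem]
  simp only [PTree.elemList_eq_map, List.map_ofFn, derivApply_ofFn]
  refine congrArg _ (funext fun i => ?_)
  rw [Function.comp_apply, ← elemDiff_mk, RTree.mk_rep]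

/-- The term `h^|τ| b(τ) / σ(τ) F(τ)(y)` of a B-series. -/
def bTerm (b : RTree → ℝ) (h : ℝ) (y : EuclideanSpace ℝ (Fin N)) (τ : RTree) :
    EuclideanSpace ℝ (Fin N) :=
  h ^ τ.size • (b τ / (τ.sigma : ℝ)) • elemDiff f τ y

/-- The part of a B-series coming from the non-empty trees with at most `k` vertices. -/
def bSum (k : ℕ) (b : RTree → ℝ) (h : ℝ) (y : EuclideanSpace ℝ (Fin N)) :
    EuclideanSpace ℝ (Fin N) :=
  ∑ τ ∈ treesUpTo k, bTerm f b h y τ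

theorem bTerm_smooth (b : RTree → ℝ) (τ : RTree) :
    ContDiff ℝ ∞ fun p : ℝ × EuclideanSpace ℝ (Fin N) => bTerm f b p.1 p.2 τ :=
  (contDiff_fst.pow _).smul (((elemDiff_smooth f τ).comp contDiff_snd).const_smul _)

theorem bSum_smooth (k : ℕ) (b : RTree → ℝ) :
    ContDiff ℝ ∞ fun p : ℝ × EuclideanSpace ℝ (Fin N) => bSum f k b p.1 p.2 :=
  ContDiff.sum fun τ _ => bTerm_smooth f b τ

theorem bTerm_isBigO (b : RTree → ℝ) {τ : RTree} {k : ℕ} (hk : k ≤ τ.size)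
    (y : EuclideanSpace ℝ (Fin N)) :
    (fun h => bTerm f b h y τ) =O[𝓝 0] fun h : ℝ => h ^ k := by
  have h1 : (fun h : ℝ => h ^ τ.size) =O[𝓝 0] fun h : ℝ => h ^ k :=
    IsBigO.of_bound 1 (by
      filter_upwards [Metric.ball_mem_nhds (0 : ℝ) one_pos] with h hh
      rw [norm_pow, norm_pow, one_mul]
      exact pow_le_pow_of_le_one (norm_nonneg _) (by simpa using (mem_ball_zero_iff.mp hh).le) hk)
  refine (h1.smul (isBigO_const_const ((b τ / (τ.sigma : ℝ)) • elemDiff f τ y)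
    (one_ne_zero (α := ℝ)) _)).congr_right fun h => by simp

theorem bSum_isBigO (b : RTree → ℝ) (k : ℕ) (y : EuclideanSpace ℝ (Fin N)) :
    (fun h => bSum f k b h y) =O[𝓝 0] fun h : ℝ => h := by
  refine (IsBigO.fun_sum (s := treesUpTo k) (g := fun h : ℝ => h ^ 1) fun τ _ =>
    bTerm_isBigO f b τ.size_pos y).congr_right fun h => by simp

theorem prod_map_pow_size (h : ℝ) (s : Multiset RTree) :
    (s.map fun τ => h ^ τ.size).prod = h ^ (s.map RTree.size).sum := by
  induction s using Multiset.induction with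
  | empty => simp
  | cons a s ih => simp [pow_add, ih]

/-- Multilinear expansion produces one elementary differential for each choice of `m` branches. The
outer factor `h` accounts for the new root. -/
theorem smul_iteratedFDeriv_bSum [DecidableEq RTree] (b : RTree → ℝ) (k m : ℕ) (h : ℝ)
    (y : EuclideanSpace ℝ (Fin N)) :
    h • (m.factorial : ℝ)⁻¹ • (iteratedFDeriv ℝ m f.toFun y fun _ => bSum f k b h y) =
      ∑ s ∈ (treesUpTo k).sym m, bTerm f (graft b) h y (RTree.node s.val) := by
  let c : RTree → ℝ := fun τ => h ^ τ.size * (b τ / (τ.sigma : ℝ))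
  have h1 : (iteratedFDeriv ℝ m f.toFun y fun _ => bSum f k b h y) =
      ∑ r ∈ Fintype.piFinset fun _ : Fin m => treesUpTo k,
        ((Finset.univ.val.map r).map c).prod • elemDiff f (RTree.node (Finset.univ.val.map r)) y := by
    simp only [bSum, bTerm, smul_smul]
    rw [ContinuousMultilinearMap.map_sum_finset]
    refine Finset.sum_congr rfl fun r _ => ?_
    rw [ContinuousMultilinearMap.map_smul_univ, elemDiff_node_map, Multiset.map_map]
    rfl
  rw [h1, sum_piFinset_eq_sum_sym _ _
    fun s => (s.map c).prod • elemDiff f (RTree.node s) y, Finset.smul_sum, Finset.smul_sum]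
  refine Finset.sum_congr rfl fun s _ => ?_
  obtain ⟨s, rfl⟩ := s
  simp only [bTerm, smul_smul]
  congr 1
  rw [← mul_assoc _ _ (Multiset.prod _), inv_factorial_mul_countPerms, RTree.size_node,
    graft_node, RTree.sigma_node]
  have hc : (s.map c).prod = h ^ (s.map RTree.size).sum *
      ((s.map b).prod / ((s.map RTree.sigma).prod : ℕ)) := by
    simp only [c]
    rw [Multiset.prod_map_mul, Multiset.prod_map_div, Nat.cast_multiset_prod, Multiset.map_map]
    exact congrArg (· * _) (prod_map_pow_size h s)
  rw [hc]
  push_cast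
  rw [pow_add, pow_one]
  field_simp

/-- The Taylor expansion of `f` at `y`, with the series of `b` as increment, sorted by the number of
branches of the root. -/
theorem bSum_graft_isBigO (b : RTree → ℝ) (k : ℕ) (y : EuclideanSpace ℝ (Fin N)) :
    (fun p : ℝ × EuclideanSpace ℝ (Fin N) =>
      bSum f k (graft b) p.1 p.2 - p.1 • f.toFun (p.2 + bSum f k b p.1 p.2))
      =O[𝓝 (0, y)] fun p => p.1 ^ (k + 1) := by
  classical
  refine isBigO_of_forall_isBigO ((bSum_smooth f k _).sub (contDiff_fst.smul
    (f.smooth.comp (contDiff_snd.add (bSum_smooth f k b))))) (fun z => ?_) y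
  have hO := bSum_isBigO f b k z
  have hlim : Tendsto (fun h => bSum f k b h z) (𝓝 0) (𝓝 0) := hO.trans_tendsto tendsto_id
  have h1 : (fun h : ℝ => h • f.toFun (z + bSum f k b h z) -
      ∑ m ∈ Finset.range (k + 1), ∑ s ∈ (treesUpTo k).sym m,
        bTerm f (graft b) h z (RTree.node s.val)) =O[𝓝 0] fun h : ℝ => h ^ (k + 1) := by
    have h2 := ((taylor_add_isBigO f.smooth z k).comp_tendsto hlim).trans
      (g := fun v => ‖bSum f k b v z‖ ^ (k + 1)) (isBigO_refl _ _)
    have h3 := h2.trans ((hO.norm_left).pow (k + 1))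
    have h4 := ((continuous_id.tendsto (0 : ℝ)).isBigO_one ℝ).smul h3
    refine h4.congr (fun h => ?_) fun h => by simp
    simp only [id, Function.comp_apply, smul_sub, Finset.smul_sum, smul_iteratedFDeriv_bSum]
  have h5 : (fun h : ℝ => ∑ m ∈ Finset.range (k + 1), ∑ s ∈ (treesUpTo k).sym m,
        bTerm f (graft b) h z (RTree.node s.val) - bSum f k (graft b) h z) =O[𝓝 0]
      fun h : ℝ => h ^ (k + 1) := by
    -- A tree with at most `k` vertices has at most `k` branches, each with at most `k` vertices, so
    -- it occurs exactly once. The remaining trees are larger and contribute `O(h^(k+1))`.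
    have hsplit : ∀ h : ℝ, ∑ m ∈ Finset.range (k + 1), ∑ s ∈ (treesUpTo k).sym m,
        bTerm f (graft b) h z (RTree.node s.val) =
        bSum f k (graft b) h z +
        ∑ x ∈ ((Finset.range (k + 1)).sigma fun m => (treesUpTo k).sym m) with
          ¬ (RTree.node x.2.val).size ≤ k, bTerm f (graft b) h z (RTree.node x.2.val) := by
      intro h
      rw [Finset.sum_sigma', ← Finset.sum_filter_add_sum_filter_not _
        (fun x : (_ : ℕ) × Sym RTree _ => (RTree.node x.2.val).size ≤ k)]
      congr 1
      refine Finset.sum_nbij (fun x => RTree.node x.2.val) ?_ ?_ ?_ fun _ _ => rfl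
      · intro x hx
        exact mem_treesUpTo.mpr (Finset.mem_filter.mp hx).2
      · rintro ⟨m, ⟨s, rfl⟩⟩ _ ⟨m', ⟨s', rfl⟩⟩ _ hss
        obtain rfl : s = s' := RTree.node_injective hss
        rfl
      · intro τ hτ
        have hτk : τ.size ≤ k := mem_treesUpTo.mp hτ
        have hmem : ∀ θ ∈ τ.children, θ.size < τ.size := fun θ hθ => by
          simpa using RTree.size_lt_of_mem hθ
        have hcard : τ.children.card ≤ τ.size := by
          have h1 := RTree.size_node τ.children
          have h2 : τ.children.card • 1 ≤ (τ.children.map RTree.size).sum := by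
            have := Multiset.card_nsmul_le_sum (s := τ.children.map RTree.size) (a := 1) (by
              intro x hx
              obtain ⟨θ, _, rfl⟩ := Multiset.mem_map.mp hx
              exact θ.size_pos)
            simpa using this
          rw [RTree.node_children] at h1
          simp only [smul_eq_mul, mul_one] at h2
          omega
        refine ⟨⟨τ.children.card, ⟨τ.children, rfl⟩⟩, ?_, τ.node_children⟩
        simp only [Finset.coe_filter, Finset.mem_sigma, Finset.mem_range, Set.mem_ofPred_eq,
          Finset.mem_sym_iff, RTree.node_children]
        refine ⟨⟨by omega, fun θ hθ => ?_⟩, hτk⟩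
        have := hmem θ hθ
        exact mem_treesUpTo.mpr (by omega)
    simp only [hsplit, add_sub_cancel_left]
    refine IsBigO.fun_sum fun x hx => bTerm_isBigO f _ ?_ z
    have := (Finset.mem_filter.mp hx).2
    omega
  refine ((h1.add h5).neg_left).congr_left fun h => ?_
  simp

/-! ### Composition of B-series -/

/-- The values of a character on the non-empty trees. -/
def values (φ : Character) (τ : RTree) : ℝ := φ (MvPolynomial.X τ)

theorem values_conv (φ ψ : Character) : values (conv φ ψ) = values φ + cutSum φ (values ψ) :=
  funext fun τ => conv_X φ ψ τ

section

variable {N : ℕ} (f : VectorField N)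

theorem bSum_add (k : ℕ) (b b' : RTree → ℝ) (h : ℝ) (y : EuclideanSpace ℝ (Fin N)) :
    bSum f k (b + b') h y = bSum f k b h y + bSum f k b' h y := by
  simp [bSum, bTerm, add_div, add_smul, Finset.sum_add_distrib]

theorem bSum_smul (k : ℕ) (r : ℝ) (b : RTree → ℝ) (h : ℝ) (y : EuclideanSpace ℝ (Fin N)) :
    bSum f k (r • b) h y = r • bSum f k b h y := by
  rw [bSum, bSum, Finset.smul_sum]
  refine Finset.sum_congr rfl fun τ _ => ?_
  simp only [bTerm, Pi.smul_apply, smul_smul, smul_eq_mul]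
  congr 1
  ring

theorem bSum_congr {k : ℕ} {b b' : RTree → ℝ} (hb : ∀ τ : RTree, τ.size ≤ k → b τ = b' τ) (h : ℝ)
    (y : EuclideanSpace ℝ (Fin N)) : bSum f k b h y = bSum f k b' h y :=
  Finset.sum_congr rfl fun τ hτ => by rw [bTerm, bTerm, hb τ (mem_treesUpTo.mp hτ)]

theorem trunc_bSeries (φ : Character) (k : ℕ) (h : ℝ) (y : EuclideanSpace ℝ (Fin N)) :
    (bSeries φ N f).trunc k h y = y + bSum f k (values φ) h y := by
  have h0 : treesOfSize 0 = ∅ := by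
    ext τ
    simpa using τ.size_pos.ne'
  rw [FormalMap.trunc, bSum, sum_treesUpTo, Finset.sum_range_succ', Finset.sum_range_succ',
    h0, Finset.sum_empty, add_zero, add_comm]
  simp only [bSeries, pow_zero, one_smul, if_true]
  refine congrArg _ (Finset.sum_congr rfl fun n _ => ?_)
  rw [if_neg (Nat.succ_ne_zero n), Finset.smul_sum]
  refine Finset.sum_congr rfl fun τ hτ => ?_
  rw [bTerm, mem_treesOfSize.mp hτ, values]

theorem tendsto_add_bSum (b : RTree → ℝ) (k : ℕ) (y : EuclideanSpace ℝ (Fin N)) :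
    Tendsto (fun p : ℝ × EuclideanSpace ℝ (Fin N) => p.2 + bSum f k b p.1 p.2)
      (𝓝 (0, y)) (𝓝 y) := by
  have h1 := (continuous_snd.add (bSum_smooth f k b).continuous).tendsto ((0 : ℝ), y)
  have h2 : bSum f k b 0 y = 0 :=
    Finset.sum_eq_zero fun τ _ => by rw [bTerm, zero_pow τ.size_pos.ne', zero_smul]
  simp only [Pi.add_apply, h2, add_zero] at h1
  exact h1

/-- The functions `b` on trees for which substituting the B-series of `φ` into the one of `b` gives
the B-series of `cutSum φ b`, up to terms of order larger than `k`. -/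
def substitutable (φ : Character) (k : ℕ) : Submodule ℝ (RTree → ℝ) where
  carrier := {b | ∀ y, (fun p : ℝ × EuclideanSpace ℝ (Fin N) =>
    bSum f k b p.1 (p.2 + bSum f k (values φ) p.1 p.2) - bSum f k (cutSum φ b) p.1 p.2)
      =O[𝓝 (0, y)] fun p => p.1 ^ (k + 1)}
  zero_mem' y := by
    have h0 : ∀ h z, bSum f k 0 h z = 0 := fun h z => by
      simpa using bSum_smul f k 0 0 h z
    have h1 : cutSum φ 0 = 0 := by simpa using cutSum_smul φ 0 0
    simpa [h0, h1] using isBigO_zero _ _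
  add_mem' ha hb y := by
    refine ((ha y).add (hb y)).congr_left fun p => ?_
    rw [cutSum_add, bSum_add, bSum_add]
    abel
  smul_mem' r b hb y := by
    refine ((hb y).const_smul_left r).congr_left fun p => ?_
    simp only [Pi.smul_apply]
    rw [cutSum_smul, bSum_smul, bSum_smul, smul_sub]

/-- With `z = y + B(φ)(y)`, the series of `graft b` at `z` is `h f(z + B(b)(z))`. By hypothesis the
argument of `f` is `y + B(φ + cutSum φ b)(y)`, so the result is the series of `graft (φ + cutSum φ
b)`, and `cutSum_graft` concludes. -/
theorem graft_mem_substitutable (φ : Character) (k : ℕ) (b : RTree → ℝ)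
    (hb : b ∈ substitutable f φ k) : graft b ∈ substitutable f φ k := by
  intro y
  have hb := hb y
  let z : ℝ × EuclideanSpace ℝ (Fin N) → EuclideanSpace ℝ (Fin N) :=
    fun p => p.2 + bSum f k (values φ) p.1 p.2
  have hz : Tendsto z (𝓝 (0, y)) (𝓝 y) := tendsto_add_bSum f (values φ) k y
  have hz' : Tendsto (fun p => (p.1, z p)) (𝓝 (0, y)) (𝓝 (0, y)) :=
    (tendsto_fst_nhds y).prodMk_nhds hz
  have h1 := (bSum_graft_isBigO f b k y).comp_tendsto hz'
  have hA : ContDiff ℝ ∞ fun p : ℝ × EuclideanSpace ℝ (Fin N) => p.1 • f.toFun p.2 :=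
    contDiff_fst.smul (f.smooth.comp contDiff_snd)
  have h2 := (isBigO_comp_sub hA (tendsto_fst_nhds y)
    ((tendsto_add_bSum f b k y).comp hz')
    (tendsto_add_bSum f (values φ + cutSum φ b) k y)).trans (hb.congr_left fun p => by
      simp only [Function.comp_apply, z, bSum_add]
      abel)
  have h3 := bSum_graft_isBigO f (values φ + cutSum φ b) k y
  refine ((h1.add h2).sub h3).congr_left fun p => ?_
  have hg : cutSum φ (graft b) = graft (values φ + cutSum φ b) := cutSum_graft φ b
  simp only [Function.comp_apply, hg, z]
  abel

theorem bSum_add_bSum_isBigO (φ : Character) (k : ℕ) (b : RTree → ℝ)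
    (y : EuclideanSpace ℝ (Fin N)) : (fun p : ℝ × EuclideanSpace ℝ (Fin N) =>
      bSum f k b p.1 (p.2 + bSum f k (values φ) p.1 p.2) - bSum f k (cutSum φ b) p.1 p.2)
      =O[𝓝 (0, y)] fun p => p.1 ^ (k + 1) := by
  -- Both sides depend only on the values of `b` at trees with at most `k` vertices, since cutting
  -- never enlarges the root component.
  obtain ⟨w, hw, hwb⟩ := exists_mem_eq_of_graft_mem (substitutable f φ k)
    (graft_mem_substitutable f φ k) k b
  refine (hw y).congr_left fun p => ?_
  rw [bSum_congr f hwb, bSum_congr f (b := cutSum φ w) (b' := cutSum φ b)]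
  exact fun τ hτ => cutSum_congr φ fun θ hθ => hwb θ (hθ.trans hτ)

/-- The method applied first supplies the weights of the pruned forests; hence its character is the
left factor. -/
theorem bSeries_comp_apply (φ ψ : Character) :
    (bSeries ψ N f).comp (bSeries φ N f) = bSeries (conv φ ψ) N f := by
  refine FormalMap.comp_eq_of_isBigO fun k y => ?_
  refine (bSum_add_bSum_isBigO f φ k (values ψ) y).congr_left fun p => ?_
  rw [trunc_bSeries, trunc_bSeries, trunc_bSeries, values_conv, bSum_add]
  abel

end

/-- The composition of B-series methods is given by the product in the Butcher group. -/
theorem bSeries_comp (φ ψ : Character) :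
    (bSeries ψ).comp (bSeries φ) = bSeries (conv φ ψ) :=
  funext fun _ => funext fun f => bSeries_comp_apply f φ ψ

/-! ### Independence of the elementary differentials -/

section Semiconj

variable {E E' : Type*} [NormedAddCommGroup E] [NormedSpace ℝ E] [NormedAddCommGroup E']
  [NormedSpace ℝ E']

/-- Repeated differentiation of `A ∘ f = g ∘ A`. Through `elem_semiconj` this serves projections of
product fields and linear changes of coordinates. -/
theorem dirDeriv_semiconj {f : E → E} {g : E' → E'} (hf : ContDiff ℝ ∞ f) (hg : ContDiff ℝ ∞ g)
    (A : E →L[ℝ] E') (h : ∀ y, A (f y) = g (A y)) (l : List E) (y : E) :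
    A (dirDeriv f l y) = dirDeriv g (l.map A) (A y) := by
  induction l generalizing y with
  | nil => exact h y
  | cons v l ih =>
    have h1 : HasFDerivAt (fun y => A (dirDeriv f l y)) (A.comp (fderiv ℝ (dirDeriv f l) y)) y :=
      A.hasFDerivAt.comp y ((dirDeriv_smooth hf l).differentiable (by simp) y).hasFDerivAt
    have h2 : HasFDerivAt (fun y => dirDeriv g (l.map A) (A y))
        ((fderiv ℝ (dirDeriv g (l.map A)) (A y)).comp A) y :=
      ((dirDeriv_smooth hg _).differentiable (by simp) (A y)).hasFDerivAt.comp y A.hasFDerivAt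
    have h3 := congrArg (fun L => L v) (h1.unique (by simpa only [ih] using h2))
    simpa [dirDeriv] using h3

mutual
theorem elem_semiconj {f : E → E} {g : E' → E'} (hf : ContDiff ℝ ∞ f) (hg : ContDiff ℝ ∞ g)
    (A : E →L[ℝ] E') (h : ∀ y, A (f y) = g (A y)) (y : E) :
    ∀ t : PTree, A (PTree.elem f t y) = PTree.elem g t (A y)
  | .node ts => by
    rw [PTree.elem, PTree.elem]
    simp only [derivApply_eq_dirDeriv hf, derivApply_eq_dirDeriv hg]
    rw [dirDeriv_semiconj hf hg A h, elemList_semiconj hf hg A h y ts]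
theorem elemList_semiconj {f : E → E} {g : E' → E'} (hf : ContDiff ℝ ∞ f) (hg : ContDiff ℝ ∞ g)
    (A : E →L[ℝ] E') (h : ∀ y, A (f y) = g (A y)) (y : E) :
    ∀ ts : List PTree, (PTree.elemList f ts y).map A = PTree.elemList g ts (A y)
  | [] => by simp [PTree.elemList]
  | t :: ts => by
    rw [PTree.elemList, PTree.elemList, List.map_cons, elem_semiconj hf hg A h y t,
      elemList_semiconj hf hg A h y ts]
end

/-- The vector field `(x, z) ↦ (exp (ℓ (z - y)), f z)`. -/
def expExtension (f : E → E) (y : E) (ℓ : E →L[ℝ] ℝ) (p : ℝ × E) : ℝ × E :=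
  (Real.exp (ℓ (p.2 - y)), f p.2)

theorem expExtension_smooth {f : E → E} (hf : ContDiff ℝ ∞ f) (y : E) (ℓ : E →L[ℝ] ℝ) :
    ContDiff ℝ ∞ (expExtension f y ℓ) :=
  (Real.contDiff_exp.comp (ℓ.contDiff.comp (contDiff_snd.sub contDiff_const))).prodMk
    (hf.comp contDiff_snd)

/-- Each derivative of the exponential only adds a factor `ℓ v.2`. At `p.2 = y` the product over the
branches remains, which is exactly `graft`. -/
theorem dirDeriv_expExtension_fst {f : E → E} (hf : ContDiff ℝ ∞ f) (y : E) (ℓ : E →L[ℝ] ℝ)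
    (l : List (ℝ × E)) (p : ℝ × E) :
    (dirDeriv (expExtension f y ℓ) l p).1 =
      (l.map fun v => ℓ v.2).prod * Real.exp (ℓ (p.2 - y)) := by
  induction l generalizing p with
  | nil => simp [dirDeriv, expExtension]
  | cons v l ih =>
    have hs := (dirDeriv_smooth (expExtension_smooth hf y ℓ) l).differentiable (by simp) p
    have h1 : HasFDerivAt (fun p => (dirDeriv (expExtension f y ℓ) l p).1)
        ((ContinuousLinearMap.fst ℝ ℝ E).comp (fderiv ℝ (dirDeriv (expExtension f y ℓ) l) p)) p :=
      (ContinuousLinearMap.fst ℝ ℝ E).hasFDerivAt.comp p hs.hasFDerivAt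
    have h2 : HasFDerivAt (fun p : ℝ × E => ℓ (p.2 - y))
        (ℓ.comp (ContinuousLinearMap.snd ℝ ℝ E)) p :=
      ℓ.hasFDerivAt.comp p (hasFDerivAt_snd.sub_const y)
    have h3 := h2.exp.const_mul (l.map fun v => ℓ v.2).prod
    have h4 := congrArg (fun L => L v) (h1.unique (by simpa only [ih] using h3))
    simp only [ContinuousLinearMap.comp_apply, ContinuousLinearMap.coe_fst',
      ContinuousLinearMap.coe_snd', _root_.smul_apply, smul_eq_mul] at h4
    rw [dirDeriv, h4, List.map_cons, List.prod_cons]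
    ring

end Semiconj

/-- The functions `τ ↦ ℓ(F(τ)(y))` on trees, where `F` are the elementary differentials of a smooth
vector field on a finite-dimensional space, `y` is a point and `ℓ` is a linear form. -/
def observables : Submodule ℝ (RTree → ℝ) where
  carrier := {w | ∃ (E : Type) (_ : NormedAddCommGroup E) (_ : NormedSpace ℝ E)
    (_ : FiniteDimensional ℝ E) (f : E → E) (y : E) (ℓ : E →L[ℝ] ℝ),
    ContDiff ℝ ∞ f ∧ ∀ t, w (RTree.mk t) = ℓ (PTree.elem f t y)}
  zero_mem' := ⟨ℝ, inferInstance, inferInstance, inferInstance, fun _ => 0, 0, 0, contDiff_const,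
    fun _ => rfl⟩
  add_mem' := by
    rintro w w' ⟨E, _, _, _, f, y, ℓ, hf, hw⟩ ⟨E', _, _, _, f', y', ℓ', hf', hw'⟩
    -- On a product the two fields evolve independently, so a sum of linear forms on the factors
    -- adds the observables.
    have hF : ContDiff ℝ ∞ (Prod.map f f') := hf.prodMap hf'
    refine ⟨E × E', inferInstance, inferInstance, inferInstance, Prod.map f f', (y, y'),
      ℓ.comp (ContinuousLinearMap.fst ℝ E E') + ℓ'.comp (ContinuousLinearMap.snd ℝ E E'), hF,
      fun t => ?_⟩
    have h1 := elem_semiconj hF hf (ContinuousLinearMap.fst ℝ E E') (fun _ => rfl) (y, y') t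
    have h2 := elem_semiconj hF hf' (ContinuousLinearMap.snd ℝ E E') (fun _ => rfl) (y, y') t
    rw [Pi.add_apply, hw, hw', _root_.add_apply, ContinuousLinearMap.comp_apply,
      ContinuousLinearMap.comp_apply, h1, h2]
    rfl
  smul_mem' := by
    rintro r w ⟨E, _, _, _, f, y, ℓ, hf, hw⟩
    exact ⟨E, inferInstance, inferInstance, inferInstance, f, y, r • ℓ, hf, fun t => by simp [hw]⟩

theorem graft_mem_observables (b : RTree → ℝ) (hb : b ∈ observables) : graft b ∈ observables := by
  obtain ⟨E, _, _, _, f, y, ℓ, hf, hw⟩ := hb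
  have hg := expExtension_smooth hf y ℓ
  refine ⟨ℝ × E, inferInstance, inferInstance, inferInstance, expExtension f y ℓ, (0, y),
    ContinuousLinearMap.fst ℝ ℝ E, hg, ?_⟩
  rintro ⟨ts⟩
  rw [graft, RTree.children_mk, PTree.elem]
  simp only [derivApply_eq_dirDeriv hg, PTree.elemList_eq_map, ContinuousLinearMap.coe_fst']
  rw [dirDeriv_expExtension_fst hf]
  simp only [sub_self, map_zero, Real.exp_zero, mul_one, Multiset.map_coe, Multiset.prod_coe,
    List.map_map]
  refine congrArg _ (List.map_congr_left fun t _ => ?_)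
  rw [Function.comp_apply, hw]
  exact congrArg ℓ
    (elem_semiconj hg hf (ContinuousLinearMap.snd ℝ ℝ E) (fun _ => rfl) (0, y) t).symm

/-- The elementary differentials of the trees with at most `k` vertices take arbitrarily prescribed
values, for a suitable vector field and with respect to a suitable linear form. -/
theorem exists_elemDiff_eq (k : ℕ) (a : RTree → ℝ) :
    ∃ (N : ℕ) (f : VectorField N) (y : EuclideanSpace ℝ (Fin N))
      (ℓ : EuclideanSpace ℝ (Fin N) →L[ℝ] ℝ),
      ∀ τ : RTree, τ.size ≤ k → ℓ (elemDiff f τ y) = a τ := by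
  obtain ⟨w, ⟨E, _, _, _, f, y, ℓ, hf, hw⟩, hwa⟩ :=
    exists_mem_eq_of_graft_mem observables graft_mem_observables k a
  let L : E ≃L[ℝ] EuclideanSpace ℝ (Fin (Module.finrank ℝ E)) := toEuclidean
  have hg : ContDiff ℝ ∞ fun x => L (f (L.symm x)) :=
    L.contDiff.comp (hf.comp L.symm.contDiff)
  refine ⟨_, ⟨fun x => L (f (L.symm x)), hg⟩, L y, ℓ.comp (L.symm : _ →L[ℝ] E), ?_⟩
  rintro ⟨t⟩ ht
  have h1 := elem_semiconj hg hf (L.symm : _ →L[ℝ] E) (fun _ => by simp) (L y) t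
  simp only [ContinuousLinearEquiv.coe_coe, ContinuousLinearEquiv.symm_apply_apply] at h1
  rw [← hwa _ ht]
  refine Eq.trans ?_ (hw t).symm
  rw [← h1]
  rfl

theorem bSeries_injective : Function.Injective bSeries := by
  classical
  intro φ ψ h
  refine character_ext fun τ => ?_
  -- This choice isolates `τ` among all trees of its size in the coefficient of `h ^ τ.size`.
  obtain ⟨N, f, y, ℓ, hℓ⟩ := exists_elemDiff_eq τ.size (Pi.single τ 1)
  have key : ∀ χ : Character,
      ℓ ((bSeries χ N f).coeff τ.size y) = χ (MvPolynomial.X τ) / (τ.sigma : ℝ) := by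
    intro χ
    simp only [bSeries, τ.size_pos.ne', if_false, map_sum, map_smul, smul_eq_mul]
    rw [Finset.sum_eq_single τ]
    · simp [hℓ τ le_rfl]
    · intro θ hθ hne
      rw [hℓ θ (mem_treesOfSize.mp hθ).le, Pi.single_eq_of_ne hne, mul_zero]
    · simp
  have h1 := (key φ).symm.trans ((by rw [h]) : _ = _) |>.trans (key ψ)
  have h0 : (τ.sigma : ℝ) ≠ 0 := by exact_mod_cast τ.sigma_ne_zero
  exact (div_left_inj' h0).mp h1

/-! ### The Butcher group -/

theorem Method.comp_assoc (A B C : Method) : (A.comp B).comp C = A.comp (B.comp C) :=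
  funext fun N => funext fun f => FormalMap.comp_assoc (A N f) (B N f) (C N f)

theorem bSeries_counit : bSeries counit = fun _ _ => FormalMap.one := by
  funext N f
  ext n y
  by_cases hn : n = 0 <;> simp [bSeries, FormalMap.one, counit, hn]

/-- Associativity is inherited from the composition of methods, which represents characters
faithfully; coassociativity is not checked on trees. -/
theorem conv_assoc (φ₁ φ₂ φ₃ : Character) :
    conv (conv φ₁ φ₂) φ₃ = conv φ₁ (conv φ₂ φ₃) := by
  apply bSeries_injective
  simp only [← bSeries_comp, Method.comp_assoc]

theorem counit_conv (φ : Character) : conv counit φ = φ := by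
  apply bSeries_injective
  rw [← bSeries_comp, bSeries_counit]
  exact funext fun N => funext fun f => FormalMap.comp_one _

/-- The total and the empty cut give the two leading terms, and all other cuts involve only smaller
trees. Equations between characters can thus be solved by recursion on the size. -/
theorem conv_X_eq_add (φ ψ : Character) (τ : RTree) :
    conv φ ψ (MvPolynomial.X τ) = φ (MvPolynomial.X τ) + (ψ (MvPolynomial.X τ) +
      (τ.properCuts.map fun c => φ (forest c.1) * ψ (MvPolynomial.X c.2)).sum) := by
  rw [conv_X, cutSum_eq_add]

/-- Functions on trees can be defined by recursion on the number of vertices. -/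
theorem exists_eq_of_recursion (G : RTree → (RTree → ℝ) → ℝ)
    (hG : ∀ (τ : RTree) (a a' : RTree → ℝ),
      (∀ θ : RTree, θ.size < τ.size → a θ = a' θ) → G τ a = G τ a') :
    ∃ a : RTree → ℝ, ∀ τ, a τ = G τ a := by
  let step : ∀ τ : RTree, (∀ θ : RTree, θ.size < τ.size → ℝ) → ℝ := fun τ rec =>
    -- The default value `0` is never seen, because `G τ` depends only on smaller trees.
    G τ fun θ => if h : θ.size < τ.size then rec θ h else 0
  refine ⟨(measure RTree.size).wf.fix step, fun τ => ?_⟩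
  rw [WellFounded.fix_eq]
  exact hG τ _ _ fun θ hθ => dif_pos hθ

theorem exists_conv_eq_counit (φ : Character) : ∃ χ : Character, conv χ φ = counit := by
  obtain ⟨a, ha⟩ := exists_eq_of_recursion (fun τ a => -(φ (MvPolynomial.X τ) +
    (τ.properCuts.map fun c => (c.1.map a).prod * φ (MvPolynomial.X c.2)).sum))
    fun τ a a' h => by
      refine congrArg (fun s => -(_ + Multiset.sum s)) (Multiset.map_congr rfl fun c hc => ?_)
      rw [Multiset.map_congr rfl fun θ hθ =>
        h θ (RTree.size_fst_lt (RTree.mem_cuts_of_mem_properCuts hc) hθ)]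
  refine ⟨MvPolynomial.aeval a, character_ext fun τ => ?_⟩
  rw [conv_X_eq_add]
  simp only [map_forest, MvPolynomial.aeval_X, counit]
  rw [ha τ]
  ring

theorem exists_conv_self_eq (ψ : Character) : ∃ χ : Character, conv χ χ = ψ := by
  -- At `τ` the equation reads `2 a τ` plus the sum over the proper cuts equals `ψ τ`.
  obtain ⟨a, ha⟩ := exists_eq_of_recursion (fun τ a => (ψ (MvPolynomial.X τ) -
    (τ.properCuts.map fun c => (c.1.map a).prod * a c.2).sum) / 2)
    fun τ a a' h => by
      refine congrArg (fun s => (_ - Multiset.sum s) / 2) (Multiset.map_congr rfl fun c hc => ?_)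
      rw [h _ (RTree.size_snd_lt hc), Multiset.map_congr rfl fun θ hθ =>
        h θ (RTree.size_fst_lt (RTree.mem_cuts_of_mem_properCuts hc) hθ)]
  refine ⟨MvPolynomial.aeval a, character_ext fun τ => ?_⟩
  rw [conv_X_eq_add]
  simp only [map_forest, MvPolynomial.aeval_X]
  rw [ha τ]
  ring

theorem conv_self_injective : Function.Injective fun χ : Character => conv χ χ := by
  intro χ χ' h
  refine character_ext fun τ => ?_
  induction τ using RTree.size_induction with
  | h τ ih =>
    have h1 : conv χ χ (MvPolynomial.X τ) = conv χ' χ' (MvPolynomial.X τ) := by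
      simp only at h
      rw [h]
    rw [conv_X_eq_add, conv_X_eq_add] at h1
    have h2 : (τ.properCuts.map fun c => χ (forest c.1) * χ (MvPolynomial.X c.2)) =
        τ.properCuts.map fun c => χ' (forest c.1) * χ' (MvPolynomial.X c.2) := by
      refine Multiset.map_congr rfl fun c hc => ?_
      rw [ih _ (RTree.size_snd_lt hc), map_forest, map_forest, Multiset.map_congr rfl fun θ hθ =>
        ih θ (RTree.size_fst_lt (RTree.mem_cuts_of_mem_properCuts hc) hθ)]
    rw [h2] at h1
    linarith

/-- The Butcher group: the characters of `H` with the convolution product. -/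
@[reducible] def butcherGroup : Group Character :=
  letI : Mul Character := ⟨conv⟩
  letI : One Character := ⟨counit⟩
  letI : Inv Character := ⟨fun φ => (exists_conv_eq_counit φ).choose⟩
  Group.ofLeftAxioms conv_assoc counit_conv fun φ => (exists_conv_eq_counit φ).choose_spec

theorem bar_X (φ : Character) (τ : RTree) :
    bar φ (MvPolynomial.X τ) = (-1) ^ τ.size * φ (MvPolynomial.X τ) := by
  simp [bar, involution]

theorem bar_bar (φ : Character) : bar (bar φ) = φ :=
  character_ext fun τ => by
    rw [bar_X, bar_X, ← mul_assoc, ← mul_pow]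
    simp

/-- A cut distributes the vertices of the tree over its pieces, so the signs multiply to `(-1)^|τ|`.
-/
theorem bar_conv (φ ψ : Character) : bar (conv φ ψ) = conv (bar φ) (bar ψ) := by
  refine character_ext fun τ => ?_
  rw [bar_X, conv_X, conv_X, bar_X, mul_add, cutSum, cutSum, ← Multiset.sum_map_mul_left]
  refine congrArg (_ + Multiset.sum ·) (Multiset.map_congr rfl fun c hc => ?_)
  simp only [map_forest, bar_X]
  rw [Multiset.prod_map_mul, prod_map_pow_size, ← RTree.size_cuts hc, pow_add]
  ring

/-! ### Adjoint and symmetric methods -/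

theorem bSeries_bar {N : ℕ} (f : VectorField N) (φ : Character) :
    bSeries (bar φ) N f = (bSeries φ N f).reverse := by
  ext n y : 3
  simp only [bSeries, FormalMap.reverse]
  split_ifs with hn
  · simp [hn]
  · rw [Finset.smul_sum]
    refine Finset.sum_congr rfl fun τ hτ => ?_
    rw [bar_X, mem_treesOfSize.mp hτ, smul_smul, mul_div_assoc]

theorem isAdjoint_bSeries_iff (φ χ : Character) :
    (bSeries φ).IsAdjoint (bSeries χ) ↔
      conv (bar φ) χ = counit ∧ conv χ (bar φ) = counit := by
  have key : ∀ A : Method, (A = fun _ _ => FormalMap.one) ↔ ∀ N f, A N f = FormalMap.one :=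
    fun A => ⟨fun h N f => by rw [h], fun h => funext fun N => funext fun f => h N f⟩
  rw [← bSeries_injective.eq_iff, ← bSeries_injective.eq_iff, ← bSeries_comp, ← bSeries_comp,
    bSeries_counit, key, key]
  simp only [Method.comp, bSeries_bar, Method.IsAdjoint, FormalMap.IsAdjoint, forall_and]

theorem isSymmetric_bSeries_iff (φ : Character) : (bSeries φ).IsSymmetric ↔ IsOdd φ := by
  rw [Method.IsSymmetric, isAdjoint_bSeries_iff, IsOdd, and_comm]

/-- A left inverse equals a right inverse. Consequently an adjoint of a B-series method, given as an
arbitrary method, is itself a B-series method. -/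
theorem Method.IsAdjoint.unique {Φ X Y : Method} (hX : Φ.IsAdjoint X) (hY : Φ.IsAdjoint Y) :
    X = Y := by
  funext N f
  rw [← FormalMap.comp_one (X N f), ← (hY N f).2, ← FormalMap.comp_assoc, (hX N f).1,
    FormalMap.one_comp]

/-- A B-series method of the form `Ω ∘ Ω*` has an odd character. -/
theorem isOdd_of_eq_comp_adjoint {ψ ζ : Character} {Ωs : Method}
    (hΩ : (bSeries ζ).IsAdjoint Ωs) (h : bSeries ψ = (bSeries ζ).comp Ωs) : IsOdd ψ := by
  let := butcherGroup
  have hadj : (bSeries ζ).IsAdjoint (bSeries (bar ζ)⁻¹) :=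
    (isAdjoint_bSeries_iff _ _).mpr ⟨mul_inv_cancel (bar ζ), inv_mul_cancel (bar ζ)⟩
  rw [hΩ.unique hadj, bSeries_comp] at h
  have hψ : ψ = (bar ζ)⁻¹ * ζ := bSeries_injective h
  let β : Character →* Character := MonoidHom.mk' bar bar_conv
  have hbar : bar ψ = ζ⁻¹ * bar ζ := by
    change β ψ = ζ⁻¹ * β ζ
    rw [hψ, map_mul, map_inv, show β (bar ζ) = ζ from bar_bar ζ]
  constructor
  · change ψ * bar ψ = 1
    rw [hbar, hψ]
    group
  · change bar ψ * ψ = 1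
    rw [hbar, hψ]
    group

/-- The square root of an odd character is odd. -/
theorem IsOdd.of_conv_self {ψ χ : Character} (hψ : IsOdd ψ) (h : conv χ χ = ψ) : IsOdd χ := by
  let := butcherGroup
  have h1 : bar ψ = ψ⁻¹ := eq_inv_of_mul_eq_one_right hψ.1
  have h2 : bar χ = χ⁻¹ := by
    -- Both sides are square roots of `ψ⁻¹`.
    apply conv_self_injective
    change conv (bar χ) (bar χ) = χ⁻¹ * χ⁻¹
    rw [← bar_conv, h, h1, ← h]
    exact mul_inv_rev χ χ
  exact ⟨by rw [h2]; exact mul_inv_cancel χ, by rw [h2]; exact inv_mul_cancel χ⟩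

end BSeries

end

open BSeries in
theorem mainTheorem2 (ψ : Character) :
    -- `Ψ` is symmetric if and only if `Ψ = Ω ∘ Ω*` for some B-series method `Ω`
    ((bSeries ψ).IsSymmetric ↔
      ∃ (ω : Character) (Ωs : Method), (bSeries ω).IsAdjoint Ωs ∧
        bSeries ψ = (bSeries ω).comp Ωs) ∧
    -- the character has a unique square root in the Butcher group
    (∃! χ : Character, conv χ χ = ψ) ∧
    -- if `Ψ` is symmetric, this square root is odd and one may take `Ω` to be its B-series method
    ((bSeries ψ).IsSymmetric → ∀ χ : Character, conv χ χ = ψ →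
      IsOdd χ ∧ (bSeries χ).IsSymmetric ∧
        ∃ Ωs : Method, (bSeries χ).IsAdjoint Ωs ∧ bSeries ψ = (bSeries χ).comp Ωs) := by
  obtain ⟨χ₀, hχ₀⟩ := exists_conv_self_eq ψ
  have hroot : (bSeries ψ).IsSymmetric → ∀ χ : Character, conv χ χ = ψ →
      IsOdd χ ∧ (bSeries χ).IsSymmetric ∧
        ∃ Ωs : Method, (bSeries χ).IsAdjoint Ωs ∧ bSeries ψ = (bSeries χ).comp Ωs := by
    intro hψ χ hχ
    have hodd : IsOdd χ := ((isSymmetric_bSeries_iff ψ).mp hψ).of_conv_self hχ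
    have hsymm := (isSymmetric_bSeries_iff χ).mpr hodd
    -- The method of `χ` is its own adjoint, so `Ω ∘ Ω* = Ω ∘ Ω` has the character `conv χ χ`.
    exact ⟨hodd, hsymm, bSeries χ, hsymm, by rw [bSeries_comp, hχ]⟩
  refine ⟨⟨fun hψ => ?_, ?_⟩, ⟨χ₀, hχ₀, fun χ hχ => ?_⟩, hroot⟩
  · obtain ⟨-, -, Ωs, hadj, hcomp⟩ := hroot hψ χ₀ hχ₀
    exact ⟨χ₀, Ωs, hadj, hcomp⟩
  · rintro ⟨ω, Ωs, hadj, hcomp⟩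
    exact (isSymmetric_bSeries_iff ψ).mpr (isOdd_of_eq_comp_adjoint hadj hcomp)
  · exact conv_self_injective (hχ.trans hχ₀.symm)
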